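/- Let $u_k=\partial_x^k u$ (also written $u_x,u_{2x},\dots$). Differential functions are finite real linear combinations of monomials in rational powers of the $u_k$ and natural powers of the $\log u_k$, with total derivative $\partial_x$ and Euler derivative $\delta_u=\sum_k(-\partial_x)^k\,\partial/\partial u_k$. As a formal pseudo-differential operator, $\partial_x^{-1}$ is the two-sided inverse of $\partial_x$. Applied to a differential function $f$, $\partial_x^{-1}f$ is the differential function $g$ with $\partial_x g=f$ and zero constant term, if it exists. Consider Wang's recursion operators for the Hunter–Saxton equation, $$\mathcal R^{(1)}(u)=\big(2u_{2x}^{-1}\partial_x+2\partial_xu_{2x}^{-1}-u_{2x}^{-3/2}u_{3x}\partial_x^{-1}u_{2x}^{-3/2}u_{3x}\big)\partial_x,$$ $$\mathcal R^{(2)}(u)=\big(u_x^4u_{2x}^{-2}\partial_x+\partial_xu_x^4u_{2x}^{-2}-8u_x\partial_x^{-1}u_x\big)\partial_x,$$ $$\mathcal R^{(3)}(u)=\big(u_x^{-4}\partial_x+\partial_xu_x^{-4}-4h\partial_x^{-1}u_x-4u_x\partial_x^{-1}h\big)\partial_x,\quad h=u_x^{-6}u_{3x}-3u_x^{-7}u_{2x}^2,$$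 and, for $n\ge 0$, the hierarchies $K^{(i)}_{2n+3}(u)=\mathcal R^{(i)}(u)^n\,\partial_x^{-1}\delta_u f_i$ with $f_1=u_{2x}^{1/2}$, $f_2=u_x^6u_{2x}^{-1}$, $f_3=u_x^{-6}u_{2x}^2$. All members exist as uniquely determined differential functions, and $K^{(1)}_3=-\tfrac14u_{2x}^{-3/2}u_{3x}$, $K^{(2)}_3=2u_x^6u_{2x}^{-3}u_{3x}-12u_x^5u_{2x}^{-1}$, $K^{(3)}_3=2u_x^{-6}u_{3x}-6u_x^{-7}u_{2x}^2$. A change of variables $(x,u)\mapsto(P,Q)$, where $\partial_xP$ and $Q$ are differential functions, maps symmetries $K$ to $\mathbf DK$ and recursion operators $\mathcal R$ to $\mathbf D\mathcal R\mathbf D^{-1}$, where $\mathbf D=Q_u-(\partial_xP)^{-1}(\partial_xQ)P_u$ and the subscript $u$ denotes the Fréchet derivative. Start with $\mathcal T_0$: $y=\partial_x^{-1}u_x^2$, $w=u_x$, followed by $v=-w^{-1}$. The corresponding operators are $\mathbf D_0=u_x\partial_xu_x^{-2}\partial_x^{-1}u_x\partial_x$ and $\mathbf D_v=w^{-2}\mathbf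 D_0$. Put $r=v_y$. 1. Let $z=\partial_y^{-1}v_y^{1/2}$, with either branch $v_y^{1/2}=\varepsilon\,u_x^{-2}u_{2x}^{1/2}$, $\varepsilon=\pm1$, and $p=\ln r$. Then $\mathbf D=r^{-1}\big(r^{3/2}\partial_zr^{-1/2}\partial_z^{-1}r^{-1/2}\partial_z\big)\mathbf D_v$, it is invertible, and $\mathcal R^{(1)}(u)$ becomes $$4\partial_z^2-p_z^2+p_z\partial_z^{-1}p_{2z},$$ which is a recursion operator of the potential mKdV equation $p_\tau=\tfrac14p_{3z}-\tfrac1{32}p_z^3$. The potential mKdV hierarchy $H_n=(4\partial_z^2-p_z^2+p_z\partial_z^{-1}p_{2z})^n(\tfrac14p_{3z}-\tfrac1{32}p_z^3)$ consists of uniquely determined differential polynomials in $p$, and for every $n\ge0$ the symmetry $K^{(1)}_{2n+3}(u)$ becomes $-\varepsilon H_n$. So $K^{(1)}$ is the potential mKdV hierarchy, exactly for $\varepsilon=-1$ and up to the overall sign (reversal of the flow times) for $\varepsilon=1$. 2. Let $z=v$ and $p=-r^{-1}$. Then $\mathbf D=p^2\big(r^2\partial_zr^{-1}\big)\mathbf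 D_v$, it is invertible, $\mathcal R^{(2)}(u)$ becomes $2\partial_z^2$, and $K^{(2)}_{2n+3}(u)$ becomes $2^{n+1}p_{(2n+3)z}$ for every $n\ge0$. 3. In the variables $(y,v)$, with the invertible operator $\mathbf D_v$, $\mathcal R^{(3)}(u)$ becomes $2\partial_y^2$, and $K^{(3)}_{2n+3}(u)$ becomes $2^{n+1}v_{(2n+3)y}$ for every $n\ge0$. -/

import Mathlib

noncomputable section

namespace HunterSaxton

/-! ### Differential functions of one dependent variable

`Jet` is the commutative differential `ℝ`-algebra of differential functions of one dependent
variable `u`: finite real linear combinations of the monomials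
`∏ u_k ^ (a_k) * ∏ (log u_k) ^ (b_k)`, where `u_k` is the `k`-th derivative of `u`, the exponents
`a_k` are rational, and the exponents `b_k` are natural numbers. -/

/-- Exponents `(a, b)` of the monomial `∏ u_k ^ (a_k) * ∏ (log u_k) ^ (b_k)`. -/
abbrev Expo : Type := (ℕ →₀ ℚ) × (ℕ →₀ ℕ)

/-- Differential functions of one dependent variable. -/
abbrev Jet : Type := AddMonoidAlgebra ℝ Expo

/-- The monomial `∏ u_k ^ (a_k)`. -/
def mon (a : ℕ →₀ ℚ) : Jet := AddMonoidAlgebra.single (a, 0) 1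

/-- The logarithm `∑ a_k * log u_k` of the monomial `∏ u_k ^ (a_k)`. -/
def logMon (a : ℕ →₀ ℚ) : Jet :=
  a.sum fun k q => AddMonoidAlgebra.single (0, Finsupp.single k 1) (q : ℝ)

/-- The power `u_k ^ q`. -/
def upow (k : ℕ) (q : ℚ) : Jet := mon (Finsupp.single k q)

/-- The jet coordinate `u_k`, the `k`-th derivative of `u`. -/
def U (k : ℕ) : Jet := upow k 1

/-- The constant term of a differential function (the coefficient of the monomial `1`). -/
def constTerm (f : Jet) : ℝ := f.coeff 0

/-- `∂/∂u_k` of the monomial with exponents `m`. -/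
def pdMon (k : ℕ) (m : Expo) : Jet :=
  AddMonoidAlgebra.single (m.1 - Finsupp.single k 1, m.2) (m.1 k : ℝ) +
    AddMonoidAlgebra.single (m.1 - Finsupp.single k 1, m.2 - Finsupp.single k 1) (m.2 k : ℝ)

/-- `∂/∂u_k` as a linear map. -/
def pdLin (k : ℕ) : Jet →ₗ[ℝ] Jet :=
  (Finsupp.lsum ℝ fun m : Expo => LinearMap.toSpanSingleton ℝ Jet (pdMon k m)) ∘ₗ
    (AddMonoidAlgebra.coeffLinearEquiv ℝ).toLinearMap

theorem pdLin_single (k : ℕ) (m : Expo) (c : ℝ) :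
    pdLin k (AddMonoidAlgebra.single m c) = c • pdMon k m := by
  simp [pdLin]

theorem pdMon_add (k : ℕ) (m n : Expo) :
    pdMon k (m + n) = AddMonoidAlgebra.single m 1 * pdMon k n +
      AddMonoidAlgebra.single n 1 * pdMon k m := by
  obtain ⟨a, b⟩ := m
  obtain ⟨c, d⟩ := n
  have e1 : a + (c - Finsupp.single k 1) = a + c - Finsupp.single k 1 := by abel
  have e2 : c + (a - Finsupp.single k 1) = a + c - Finsupp.single k 1 := by abel
  have key : ∀ x y : ℕ →₀ ℕ, (AddMonoidAlgebra.single
      (a + c - Finsupp.single k 1, x + (y - Finsupp.single k 1)) (y k : ℝ) : Jet) =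
      AddMonoidAlgebra.single (a + c - Finsupp.single k 1, x + y - Finsupp.single k 1)
        (y k : ℝ) := by
    intro x y
    by_cases h : y k = 0
    · simp [h]
    · have : Finsupp.single k 1 ≤ y := by
        rw [Finsupp.single_le_iff]; omega
      rw [add_tsub_assoc_of_le this]
  simp only [pdMon, mul_add, AddMonoidAlgebra.single_mul_single, Prod.mk_add_mk, one_mul,
    Finsupp.add_apply, Rat.cast_add, Nat.cast_add, AddMonoidAlgebra.single_add, e1, e2, key]
  rw [add_comm d b]
  abel

/-- The partial derivative `∂/∂u_k`. -/
def pd (k : ℕ) : Derivation ℝ Jet Jet :=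
  Derivation.mk' (pdLin k) (by
    intro f g
    induction f using AddMonoidAlgebra.induction_linear with
    | zero => simp
    | add f₁ f₂ h₁ h₂ => simp only [add_mul, map_add, h₁, h₂, smul_eq_mul]; ring
    | single m c =>
      induction g using AddMonoidAlgebra.induction_linear with
      | zero => simp
      | add g₁ g₂ h₁ h₂ => simp only [mul_add, map_add, h₁, h₂, smul_eq_mul]; ring
      | single n d =>
        have hs : ∀ (p : Expo) (e : ℝ), (AddMonoidAlgebra.single p e : Jet) =
            e • AddMonoidAlgebra.single p 1 := by intro p e; simp
        rw [AddMonoidAlgebra.single_mul_single, pdLin_single, pdLin_single, pdLin_single,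
          pdMon_add, hs m c, hs n d]
        simp only [smul_eq_mul, smul_add, smul_mul_assoc, mul_smul_comm, smul_smul]
        rw [mul_comm d c])

theorem pd_finite (f : Jet) : (Function.support fun k => pd k f).Finite := by
  induction f using AddMonoidAlgebra.induction_linear with
  | zero => simp
  | add f g hf hg =>
    refine (hf.union hg).subset ?_
    intro k hk
    by_contra h
    simp only [Set.mem_union, Function.mem_support, not_or, not_not] at h
    exact hk (by simp [h.1, h.2])
  | single m c =>
    refine ((m.1.support.finite_toSet).union (m.2.support.finite_toSet)).subset ?_
    intro k hk
    by_contra h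
    simp only [Set.mem_union, Finset.mem_coe, Finsupp.mem_support_iff, not_or, not_not] at h
    refine hk ?_
    change pdLin k _ = 0
    rw [pdLin_single, pdMon, h.1, h.2]
    simp

/-- The family of all partial derivatives `∂f/∂u_k`. -/
def grad (f : Jet) : ℕ →₀ Jet := Finsupp.ofSupportFinite (fun k => pd k f) (pd_finite f)

theorem grad_apply (f : Jet) (k : ℕ) : grad f k = pd k f := rfl

/-- The derivation `∑ c_k ∂/∂u_k`. -/
def vecField (c : ℕ → Jet) : Jet →ₗ[ℝ] Jet where
  toFun f := (grad f).sum fun k g => g * c k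
  map_add' f g := by
    have h : grad (f + g) = grad f + grad g := by
      ext1 k; simp [grad_apply]
    rw [h, Finsupp.sum_add_index'] <;> simp [add_mul]
  map_smul' r f := by
    have h : grad (r • f) = r • grad f := by
      ext1 k; simp [grad_apply]
    rw [h, Finsupp.sum_smul_index' (by simp), RingHom.id_apply, Finsupp.smul_sum]
    simp

/-- The total derivative `∂ = ∑ u_{k+1} ∂/∂u_k`. -/
def tot : Jet →ₗ[ℝ] Jet := vecField fun k => U (k + 1)

/-- The evolutionary derivation `∑ (∂^k F) ∂/∂u_k`, the derivative along the flow `u_τ = F`. -/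
def evol (F : Jet) : Jet →ₗ[ℝ] Jet := vecField fun k => (tot ^ k) F

/-- The Euler derivative `δ_u f = ∑ (-∂)^k (∂f/∂u_k)`. -/
def euler (f : Jet) : Jet := (grad f).sum fun k g => ((-tot) ^ k) g

/-! ### Formal pseudo-differential operators

A formal pseudo-differential operator `∑_{k ≤ N} a_k ∂^k` is given by its coefficients `a_k`.
An operator acts on the space `Symb` of all of these by composition from the left. Two operators
are equal if and only if their actions are, since the action on the operator `1` gives back the
operator; so identities between operators are stated in the ring `Module.End ℝ Symb`. -/

/-- Coefficient sequences `(a_k)`, `k ∈ ℤ`, vanishing for all large `k`. -/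
def Symb : Submodule ℝ (ℤ → Jet) where
  carrier := {a | ∃ N : ℤ, ∀ k, N < k → a k = 0}
  zero_mem' := ⟨0, fun _ _ => rfl⟩
  add_mem' := by
    rintro a b ⟨M, hM⟩ ⟨N, hN⟩
    refine ⟨max M N, fun k hk => ?_⟩
    simp [hM k (lt_of_le_of_lt (le_max_left _ _) hk), hN k (lt_of_le_of_lt (le_max_right _ _) hk)]
  smul_mem' := by
    rintro c a ⟨M, hM⟩
    exact ⟨M, fun k hk => by simp [hM k hk]⟩

/-- The action of a linear map on all coefficients. -/
def coeffwise (L : Jet →ₗ[ℝ] Jet) : Module.End ℝ Symb where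
  toFun a := ⟨fun k => L (a.1 k), by
    obtain ⟨N, hN⟩ := a.2
    exact ⟨N, fun k hk => by simp [hN k hk]⟩⟩
  map_add' a b := by ext1; funext k; simp
  map_smul' c a := by ext1; funext k; simp

/-- Composition with the multiplication operator `f`: the `k`-th coefficient is `f * a_k`. -/
def mulS (f : Jet) : Module.End ℝ Symb := coeffwise (LinearMap.mulLeft ℝ f)

/-- Composition with `∂`: `∂ ∘ (a ∂^k) = a ∂^(k+1) + a' ∂^k`. -/
def dS : Module.End ℝ Symb where
  toFun a := ⟨fun k => a.1 (k - 1) + tot (a.1 k), by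
    obtain ⟨N, hN⟩ := a.2
    exact ⟨N + 1, fun k hk => by simp [hN k (by omega), hN (k - 1) (by omega)]⟩⟩
  map_add' a b := by ext1; funext k; simp; abel
  map_smul' c a := by ext1; funext k; simp

theorem dinv_finite (a : Symb) (k : ℤ) :
    (Function.support fun j : ℕ => ((-tot) ^ j) (a.1 (k + 1 + j))).Finite := by
  obtain ⟨N, hN⟩ := a.2
  refine (Set.finite_Iio (N - k + 1).toNat).subset ?_
  intro j hj
  by_contra h
  simp only [Set.mem_Iio, not_lt] at h
  exact hj (by
    have : N < k + 1 + j := by omega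
    simp [hN _ this])

/-- Composition with `∂⁻¹`: `∂⁻¹ ∘ (a ∂^k) = ∑_{j ≥ 0} (-1)^j a^{(j)} ∂^(k-1-j)`. -/
def dinvS : Module.End ℝ Symb where
  toFun a := ⟨fun k => ∑ᶠ j : ℕ, ((-tot) ^ j) (a.1 (k + 1 + j)), by
    obtain ⟨N, hN⟩ := a.2
    refine ⟨N, fun k hk => ?_⟩
    have : ∀ j : ℕ, ((-tot) ^ j) (a.1 (k + 1 + j)) = 0 := fun j => by
      rw [hN _ (by omega), map_zero]
    simp [this]⟩
  map_add' a b := by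
    ext1; funext k
    simp only [Submodule.coe_add, Pi.add_apply, map_add]
    exact finsum_add_distrib (dinv_finite a k) (dinv_finite b k)
  map_smul' c a := by
    ext1; funext k
    simp only [Submodule.coe_smul, Pi.smul_apply, map_smul, RingHom.id_apply]
    exact (smul_finsum c _).symm

theorem dS_mul_dinvS : dS * dinvS = 1 := by
  ext1 a
  ext1; funext k
  change (∑ᶠ j : ℕ, ((-tot) ^ j) (a.1 (k - 1 + 1 + j))) +
    tot (∑ᶠ j : ℕ, ((-tot) ^ j) (a.1 (k + 1 + j))) = a.1 k
  rw [show tot (∑ᶠ j : ℕ, ((-tot) ^ j) (a.1 (k + 1 + j))) =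
    ∑ᶠ j : ℕ, tot (((-tot) ^ j) (a.1 (k + 1 + j))) from
      AddMonoidHom.map_finsum tot.toAddMonoidHom (dinv_finite a k)]
  have hf := dinv_finite a (k - 1)
  obtain ⟨N, hN⟩ := a.2
  set B := (N - k + 1).toNat
  have h0 : ∀ j : ℕ, B ≤ j → a.1 (k + j) = 0 := fun j hj => hN _ (by omega)
  rw [finsum_eq_sum_of_support_subset (s := Finset.range (B + 1)),
    finsum_eq_sum_of_support_subset (s := Finset.range B), Finset.sum_range_succ']
  · have : ∀ j : ℕ, ((-tot) ^ (j + 1)) (a.1 (k - 1 + 1 + ((j + 1 : ℕ) : ℤ))) +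
        tot (((-tot) ^ j) (a.1 (k + 1 + j))) = 0 := by
      intro j
      rw [pow_succ']
      have : k - 1 + 1 + ((j + 1 : ℕ) : ℤ) = k + 1 + j := by push_cast; ring
      rw [this]
      simp
    rw [add_right_comm, ← Finset.sum_add_distrib, Finset.sum_eq_zero (fun j _ => this j)]
    simp
  · intro j hj
    by_contra h
    simp only [Finset.coe_range, Set.mem_Iio, not_lt] at h
    refine hj ?_
    have : k + 1 + (j : ℤ) = k + ((j + 1 : ℕ) : ℤ) := by push_cast; ring
    simp only [this, h0 (j + 1) (by omega), map_zero]
  · intro j hj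
    by_contra h
    simp only [Finset.coe_range, Set.mem_Iio, not_lt] at h
    refine hj ?_
    have : k - 1 + 1 + (j : ℤ) = k + j := by ring
    simp only [this, h0 j (by omega), map_zero]

theorem dinvS_mul_dS : dinvS * dS = 1 := by
  ext1 a
  ext1; funext k
  change (∑ᶠ j : ℕ, ((-tot) ^ j) (a.1 (k + 1 + j - 1) + tot (a.1 (k + 1 + j)))) = a.1 k
  obtain ⟨N, hN⟩ := a.2
  set B := (N - k + 1).toNat
  have h0 : ∀ j : ℕ, B ≤ j → a.1 (k + j) = 0 := fun j hj => hN _ (by omega)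
  have hg : ∀ j : ℕ, ((-tot) ^ j) (a.1 (k + 1 + j - 1) + tot (a.1 (k + 1 + j))) =
      ((-tot) ^ j) (a.1 (k + j)) - ((-tot) ^ (j + 1)) (a.1 (k + ((j + 1 : ℕ) : ℤ))) := by
    intro j
    have e1 : k + 1 + (j : ℤ) - 1 = k + j := by ring
    have e2 : k + 1 + (j : ℤ) = k + ((j + 1 : ℕ) : ℤ) := by push_cast; ring
    rw [e1, e2, pow_succ]
    simp
  simp only [hg]
  rw [finsum_eq_sum_of_support_subset (s := Finset.range B)]
  · rw [Finset.sum_range_sub' (fun j : ℕ => ((-tot) ^ j) (a.1 (k + j)))]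
    simp [h0 B le_rfl]
  · intro j hj
    by_contra h
    simp only [Finset.coe_range, Set.mem_Iio, not_lt] at h
    refine hj ?_
    simp only [h0 j h, h0 (j + 1) (by omega), map_zero, sub_zero]

/-! ### Nonlocal operators

Expressions built from differential operators and `∂⁻¹`. Such an expression is read in two ways:
as a formal pseudo-differential operator (`toPDO`), and as an operator on differential functions
(`Apply`). -/

/-- Expressions for operators built from differential operators `∑ c_k ∂^k` and `∂⁻¹`. -/
inductive NOp : Type
  | diff (c : ℕ →₀ Jet) : NOp
  | dinv : NOp
  | add (S T : NOp) : NOp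
  | comp (S T : NOp) : NOp

namespace NOp

instance : Add NOp := ⟨add⟩
instance : Mul NOp := ⟨comp⟩

/-- Multiplication by `f`. -/
def fn (f : Jet) : NOp := diff (Finsupp.single 0 f)

/-- The operator `∂`. -/
def D : NOp := diff (Finsupp.single 1 1)

instance : Sub NOp := ⟨fun S T => S + fn (-1) * T⟩

/-- The operator as a formal pseudo-differential operator. -/
def toPDO : NOp → Module.End ℝ Symb
  | diff c => c.sum fun k f => mulS f * dS ^ k
  | dinv => dinvS
  | add S T => toPDO S + toPDO T
  | comp S T => toPDO S * toPDO T

/-- `Apply T f g` says that `T f = g` for the operator `T` acting on differential functions.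
Here `∂⁻¹ f` is the differential function `g` with `∂ g = f` and with constant term zero, if there
is one: all integration constants are zero. -/
def Apply : NOp → Jet → Jet → Prop
  | diff c, f, g => g = c.sum fun k a => a * (tot ^ k) f
  | dinv, f, g => tot g = f ∧ constTerm g = 0
  | add S T, f, g => ∃ g₁ g₂, Apply S f g₁ ∧ Apply T f g₂ ∧ g = g₁ + g₂
  | comp S T, f, g => ∃ h, Apply T f h ∧ Apply S h g

end NOp

open NOp

/-- The Fréchet derivative `∑ (∂f/∂u_k) ∂^k`. -/
def frechet (f : Jet) : NOp := diff (grad f)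

/-! ### Changes of variables

A change of variables `(x, u) ↦ (y, q)`, `y = P`, is given by the differential functions
`g = ∂_x P` and `q`; here `P = ∂_x⁻¹ g` need not be local. -/

/-- The derivation `∂_y = (∂_x P)⁻¹ ∂_x` of differential functions, where `g = ∂_x P`. -/
def dvar (g : Jet) (f : Jet) : Jet := Ring.inverse g * tot f

/-- The operator `∂_y = (∂_x P)⁻¹ ∂_x`, where `g = ∂_x P`. -/
def Dvar (g : Jet) : NOp := fn (Ring.inverse g) * D

/-- The operator `∂_y⁻¹ = ∂_x⁻¹ ∂_x P`, where `g = ∂_x P`. -/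
def DvarInv (g : Jet) : NOp := dinv * fn g

/-- The operator `q_u - (∂_x P)⁻¹ (∂_x q) P_u` that maps symmetries in the variables `(x, u)` to
symmetries in the variables `(y, q)`, where `y = P` and `g = ∂_x P`, so that `P_u = ∂_x⁻¹ g_u`. -/
def changeOp (g q : Jet) : NOp :=
  frechet q - fn (Ring.inverse g * tot q) * (dinv * frechet g)

/-- `IsTransformed T S S'` says that `T` is an invertible formal pseudo-differential operator and
`T S T⁻¹ = S'`. -/
def IsTransformed (T S S' : NOp) : Prop :=
  IsUnit T.toPDO ∧ T.toPDO * S.toPDO * Ring.inverse T.toPDO = S'.toPDO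

/-! ### Wang's recursion operators and hierarchies -/

/-- `(2 u_xx⁻¹ ∂ + 2 ∂ u_xx⁻¹ - u_xx^(-3/2) u_xxx ∂⁻¹ u_xx^(-3/2) u_xxx) ∂`. -/
def R1 : NOp :=
  (fn (2 * upow 2 (-1)) * D + fn 2 * (D * fn (upow 2 (-1))) -
    fn (upow 2 (-3 / 2) * U 3) * (dinv * fn (upow 2 (-3 / 2) * U 3))) * D

/-- `(u_x^4 u_xx⁻² ∂ + ∂ u_x^4 u_xx⁻² - 8 u_x ∂⁻¹ u_x) ∂`. -/
def R2 : NOp :=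
  (fn (upow 1 4 * upow 2 (-2)) * D + D * fn (upow 1 4 * upow 2 (-2)) -
    fn (8 * U 1) * (dinv * fn (U 1))) * D

/-- `u_x⁻⁶ u_xxx - 3 u_x⁻⁷ u_xx²`. -/
def h3 : Jet := upow 1 (-6) * U 3 - 3 * (upow 1 (-7) * upow 2 2)

/-- `(u_x⁻⁴ ∂ + ∂ u_x⁻⁴ - 4 h ∂⁻¹ u_x - 4 u_x ∂⁻¹ h) ∂`, `h = u_x⁻⁶ u_xxx - 3 u_x⁻⁷ u_xx²`. -/
def R3 : NOp :=
  (fn (upow 1 (-4)) * D + D * fn (upow 1 (-4)) - fn (4 * h3) * (dinv * fn (U 1)) -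
    fn (4 * U 1) * (dinv * fn h3)) * D

/-- `K n = R ^ n S₀` for all `n`. -/
def IsHierarchy (R : NOp) (S₀ : Jet) (K : ℕ → Jet) : Prop :=
  K 0 = S₀ ∧ ∀ n, R.Apply (K n) (K (n + 1))

/-- `K n = R ^ n ∂⁻¹ δ_u f` for all `n`. -/
def IsHierarchyOf (R : NOp) (f : Jet) (K : ℕ → Jet) : Prop :=
  dinv.Apply (euler f) (K 0) ∧ IsHierarchy R (K 0) K

/-! ### The new variables -/

/-- `w = u_x`. -/
def w : Jet := U 1

/-- `∂y/∂x = u_x²` for `y = ∂_x⁻¹ u_x²`. -/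
def gy : Jet := U 1 ^ 2

/-- `v = -w⁻¹`. -/
def v : Jet := -upow 1 (-1)

/-- The exponents of the monomial `r = v_y = u_x⁻⁴ u_xx`. -/
def rExp : ℕ →₀ ℚ := Finsupp.single 2 1 - Finsupp.single 1 4

/-- The power `r ^ q` of `r = v_y`. -/
def rpow (q : ℚ) : Jet := mon (q • rExp)

/-- `p = log r`. -/
def p1 : Jet := logMon rExp

/-- `p = -r⁻¹`. -/
def p2 : Jet := -rpow (-1)

/-- A square root of `r = v_y`; `ε = ±1` selects the branch. -/
def rsqrt (ε : ℝ) : Jet := ε • rpow (1 / 2)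

/-- `∂z/∂x` for `z = ∂_y⁻¹ v_y^(1/2)`. -/
def gz1 (ε : ℝ) : Jet := rsqrt ε * gy

/-- `∂z/∂x` for `z = v`. -/
def gz2 : Jet := tot v

theorem mon_add (a b : ℕ →₀ ℚ) : mon (a + b) = mon a * mon b := by
  simp [mon, AddMonoidAlgebra.single_mul_single]

theorem mon_zero : mon 0 = 1 := rfl

theorem tot_eq_sum (f : Jet) (s : Finset ℕ) (h : ∀ k, k ∉ s → pd k f = 0) :
    tot f = ∑ k ∈ s, pd k f * U (k + 1) := by
  change ((grad f).sum fun k g => g * U (k + 1)) = _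
  refine Finsupp.sum_of_support_subset _ (fun k hk => ?_) _ (by simp)
  by_contra hks
  exact (Finsupp.mem_support_iff.mp hk) (h k hks)

theorem pd_mon (k : ℕ) (a : ℕ →₀ ℚ) :
    pd k (mon a) = (a k : ℝ) • mon (a - Finsupp.single k 1) := by
  change pdLin k _ = _
  rw [mon, pdLin_single, pdMon]
  simp [mon]

/-- `∂_y v = r`, where `∂_y = u_x⁻² ∂_x`. -/
theorem dvar_v : dvar gy v = rpow 1 := by
  have hg : gy * upow 1 (-2) = 1 := by
    rw [gy, U, upow, upow, sq, ← mon_add, ← mon_add, ← mon_zero]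
    congr 1
    rw [← Finsupp.single_add, ← Finsupp.single_add]
    norm_num
  have hi : Ring.inverse gy = upow 1 (-2) := by
    rw [← Ring.inverse_mul_cancel_left gy (upow 1 (-2)) (IsUnit.of_mul_eq_one _ hg), hg, mul_one]
  have ht : tot v = upow 1 (-2) * U 2 := by
    rw [v, map_neg, tot_eq_sum (upow 1 (-1)) {1}]
    · rw [Finset.sum_singleton, upow, pd_mon, ← Finsupp.single_sub]
      norm_num [upow]
    · intro k hk
      rw [upow, pd_mon, Finsupp.single_eq_of_ne (by simpa using hk)]
      simp
  rw [dvar, hi, ht, upow, U, upow, rpow, ← mon_add, ← mon_add]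
  congr 1
  ext j
  by_cases h1 : j = 1
  · subst h1; simp [rExp]; norm_num
  · by_cases h2 : j = 2
    · subst h2; simp [rExp]
    · simp [rExp, Finsupp.single_eq_of_ne h1, Finsupp.single_eq_of_ne h2]

/-- `(r^(1/2))² = r`. -/
theorem rsqrt_sq (ε : ℝ) (h : ε = 1 ∨ ε = -1) : rsqrt ε ^ 2 = rpow 1 := by
  have : rpow (1 / 2) * rpow (1 / 2) = rpow 1 := by
    rw [rpow, rpow, ← mon_add, ← add_smul]
    norm_num
  rcases h with rfl | rfl <;> simp [rsqrt, sq] <;> simpa using this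

/-- `dp = dr / r` for `p = log r`. -/
theorem pd_p1 (k : ℕ) : rpow 1 * pd k p1 = pd k (rpow 1) := by
  have hl : ∀ j : ℕ, ∀ c : ℝ, pd k (AddMonoidAlgebra.single (0, Finsupp.single j 1) c) =
      if j = k then c • mon (-Finsupp.single k 1) else 0 := by
    intro j c
    change pdLin k _ = _
    rw [pdLin_single, pdMon]
    split_ifs with hjk
    · subst hjk; simp [mon]
    · simp [Finsupp.single_eq_of_ne (Ne.symm hjk)]
  have hp : pd k p1 = (rExp k : ℝ) • mon (-Finsupp.single k 1) := by
    rw [p1, logMon, Finsupp.sum, map_sum]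
    simp only [hl]
    rw [Finset.sum_ite_eq' ]
    split_ifs with hk
    · rfl
    · simp [Finsupp.notMem_support_iff.mp hk]
  rw [hp, rpow, one_smul, pd_mon, sub_eq_add_neg, mon_add, mul_smul_comm]

/-! ### The potential mKdV equation -/

/-- `4 ∂_z² - p_z² + p_z ∂_z⁻¹ p_zz`, where `g = ∂z/∂x`. -/
def pmKdVOp (g p : Jet) : NOp :=
  fn 4 * (Dvar g * Dvar g) - fn (dvar g p ^ 2) +
    fn (dvar g p) * (DvarInv g * fn (dvar g (dvar g p)))

/-- `p_zzz / 4 - p_z³ / 32` in the jet coordinates of `p`. -/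
def pmKdVFlow : Jet := (1 / 4 : ℝ) • U 3 - (1 / 32 : ℝ) • U 1 ^ 3

/-- `R` is a recursion operator of the evolution equation `u_τ = F`: it commutes with `∂_τ - F_u`,
where `∂_τ` is the derivative along the flow. -/
def IsRecursionOperator (R : NOp) (F : Jet) : Prop :=
  Commute (coeffwise (evol F) - (frechet F).toPDO) R.toPDO

/-- A polynomial in the jet coordinates as a differential function. -/
def ofPoly (H : MvPolynomial ℕ ℝ) : Jet := MvPolynomial.aeval U H

/-- The potential mKdV hierarchy, as differential polynomials in the jet coordinates of `p`. -/
def IsPmKdVHierarchy (H : ℕ → MvPolynomial ℕ ℝ) : Prop :=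
  IsHierarchy (pmKdVOp 1 (U 0)) pmKdVFlow fun n => ofPoly (H n)

end HunterSaxton

end

/-!
The operator identities and the statements on hierarchies are proved separately.

*Operators.* In the new independent variable `z`, with `g = ∂z/∂x`, put `d = ∂_z = g⁻¹ ∂` and
`e = ∂_z⁻¹ = ∂⁻¹ g`. All that is used about them is that `d` is a derivation with inverse `e`
(`IsDPair`), which yields integration by parts `e f d = f - e f'`. In these terms the three
recursion operators and the operators of the changes of variables become

* `4d² - 4α e α d` and `d² - 2φ d - β e α d`, where `α = g'/g`, `φ = w'/w`, `β = α - 2φ = p'/2`,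
* `2d² - 8w e w d` and `d² - 2w d`,
* `2d² - 4h e w d - 4w e h d` and `d - 2v' e w d`,

where `'` is the derivative along `d`. Since `φ' = φ(α - φ)` in the first case, `w' = w²` in the
second, and `h = (log w)''/w` in the third, these operators intertwine the recursion operators
with `4d² - 4β e β d`, `2d²` and `2d²`: `IsDPair.intertwine_mKdV`, `IsDPair.intertwine_linear_local`
and `IsDPair.intertwine_linear_nonlocal`. The operators of the changes of variables are invertible
since they factor through functions, `∂` and `∂⁻¹`.

*Hierarchies.* For differential functions `∂⁻¹` is only a partial operation, so the primitives
have to be exhibited. The kernel of `∂` consists of the constants (`eq_const_of_tot_eq_zero`), and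
constants of integration are excluded by scaling `u`: all functions that occur have, with a
suitable sign, negative degree (`degLE`). The linear hierarchies have explicit members: with
`q = p_{2nz}` the second one is `2ⁿ⁺¹ (q' + 2wq)`, and with `q = v_{(2n+2)y}` the third one is
`-2ⁿ⁺¹ (2wA + q)`, where `A' = v q'` is a quadratic differential polynomial in `v`. The first one is
a multiple of the mKdV hierarchy `L n = (4∂² - a ∂⁻¹ a ∂)ⁿ a` at `a = 2α`. The primitive of
`a ∂ L n` exists because the recursion operator is symmetric and the pairing `f ∂ g` is
skew-symmetric modulo total derivatives (`X_mul_dX_mkdv_mem_range`). The change of variables takes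
`L n` at `a = 2α` to a multiple of `L (n + 1)` at `a = 2β = p_z` (`miura_mkdv`), and these are the
members of the potential mKdV hierarchy.
-/

noncomputable section

namespace HunterSaxton

open NOp AddMonoidAlgebra

/-! ### Derivations of the differential functions -/

theorem vecField_eq_sum (c : ℕ → Jet) (f : Jet) (s : Finset ℕ) (h : ∀ k, k ∉ s → pd k f = 0) :
    vecField c f = ∑ k ∈ s, pd k f * c k := by
  change ((grad f).sum fun k g => g * c k) = _
  refine Finsupp.sum_of_support_subset _ (fun k hk => ?_) _ (by simp)
  by_contra hks
  exact (Finsupp.mem_support_iff.mp hk) (h k hks)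

/-- A finite set of indices outside of which all partial derivatives of `f` vanish. -/
def vars (f : Jet) : Finset ℕ := (pd_finite f).toFinset

theorem pd_eq_zero_of_notMem_vars {f : Jet} {k : ℕ} (h : k ∉ vars f) : pd k f = 0 := by
  simpa [vars] using h

theorem vecField_mul (c : ℕ → Jet) (f g : Jet) :
    vecField c (f * g) = f * vecField c g + g * vecField c f := by
  rw [vecField_eq_sum c (f * g) (vars f ∪ vars g), vecField_eq_sum c f (vars f ∪ vars g),
    vecField_eq_sum c g (vars f ∪ vars g), Finset.mul_sum, Finset.mul_sum,
    ← Finset.sum_add_distrib]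
  · refine Finset.sum_congr rfl fun k _ => ?_
    rw [Derivation.leibniz]
    simp only [smul_eq_mul]
    ring
  all_goals
    intro k hk
    simp only [Finset.mem_union, not_or] at hk
    simp [pd_eq_zero_of_notMem_vars hk.1, pd_eq_zero_of_notMem_vars hk.2]

/-- `vecField c` as a derivation. -/
def vecDer (c : ℕ → Jet) : Derivation ℝ Jet Jet :=
  Derivation.mk' (vecField c) fun f g => by simpa using vecField_mul c f g

/-- The total derivative as a derivation. -/
def totD : Derivation ℝ Jet Jet := vecDer fun k => U (k + 1)

theorem totD_apply (f : Jet) : totD f = tot f := rfl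

theorem tot_mul (f g : Jet) : tot (f * g) = f * tot g + g * tot f :=
  vecField_mul _ f g

theorem pd_single (k : ℕ) (m : Expo) (c : ℝ) : pd k (single m c) = c • pdMon k m :=
  pdLin_single k m c

theorem pd_comm (j k : ℕ) (f : Jet) : pd j (pd k f) = pd k (pd j f) := by
  rcases eq_or_ne j k with rfl | hjk
  · rfl
  induction f using AddMonoidAlgebra.induction_linear with
  | zero => simp
  | add f g hf hg => simp only [map_add, hf, hg]
  | single m c =>
    obtain ⟨a, b⟩ := m
    have e1 : a - Finsupp.single k 1 - Finsupp.single j 1 =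
        a - Finsupp.single j 1 - Finsupp.single k 1 := by abel
    have e2 : b - Finsupp.single k 1 - Finsupp.single j 1 =
        b - Finsupp.single j 1 - Finsupp.single k 1 := tsub_right_comm
    have e3 : ∀ b : ℕ →₀ ℕ, (b - Finsupp.single k 1 : ℕ →₀ ℕ) j = b j := fun b => by
      simp [Finsupp.single_eq_of_ne hjk]
    have e4 : ∀ b : ℕ →₀ ℕ, (b - Finsupp.single j 1 : ℕ →₀ ℕ) k = b k := fun b => by
      simp [Finsupp.single_eq_of_ne hjk.symm]
    have e5 : (a - Finsupp.single k 1 : ℕ →₀ ℚ) j = a j := by simp [Finsupp.single_eq_of_ne hjk]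
    have e6 : (a - Finsupp.single j 1 : ℕ →₀ ℚ) k = a k := by
      simp [Finsupp.single_eq_of_ne hjk.symm]
    simp only [pd_single, pdMon, map_add, AddMonoidAlgebra.smul_single, smul_add, smul_eq_mul,
      e1, e2, e3, e4, e5, e6]
    simp only [mul_comm, mul_left_comm, mul_assoc]
    abel

theorem pd_U (j k : ℕ) : pd j (U k) = if j = k then 1 else 0 := by
  rw [U, upow, pd_mon]
  split_ifs with h
  · subst h; simp [mon_zero]
  · simp [Finsupp.single_eq_of_ne h]

/-- The commutation relation `[∂/∂u_{k+1}, ∂] = ∂/∂u_k`. -/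
theorem pd_succ_tot (k : ℕ) (f : Jet) : pd (k + 1) (tot f) = tot (pd (k + 1) f) + pd k f := by
  rw [tot_eq_sum f (insert k (vars f)), tot_eq_sum (pd (k + 1) f) (insert k (vars f)), map_sum]
  · have : ∀ i ∈ insert k (vars f), pd (k + 1) (pd i f * U (i + 1)) =
        pd i (pd (k + 1) f) * U (i + 1) + if k = i then pd i f else 0 := by
      intro i _
      rw [Derivation.leibniz, pd_U, pd_comm]
      simp only [smul_eq_mul, Nat.add_right_cancel_iff]
      split_ifs <;> ring
    rw [Finset.sum_congr rfl this, Finset.sum_add_distrib, Finset.sum_ite_eq]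
    simp
  all_goals
    intro i hi
    simp only [Finset.mem_insert, not_or] at hi
    simp [pd_eq_zero_of_notMem_vars hi.2, pd_comm i]

/-- The derivation along a flow commutes with the total derivative. -/
theorem evol_tot (F f : Jet) : evol F (tot f) = tot (evol F f) := by
  have hs : ∀ (c : ℕ → Jet) (j : ℕ), vecField c (pd j f) = ∑ k ∈ vars f, pd k (pd j f) * c k := by
    intro c j
    refine vecField_eq_sum c _ _ fun k hk => ?_
    rw [pd_comm, pd_eq_zero_of_notMem_vars hk, map_zero]
  have ht : tot f = ∑ k ∈ vars f, pd k f * U (k + 1) :=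
    tot_eq_sum f _ fun k hk => pd_eq_zero_of_notMem_vars hk
  have he : evol F f = ∑ k ∈ vars f, pd k f * (tot ^ k) F :=
    vecField_eq_sum _ f _ fun k hk => pd_eq_zero_of_notMem_vars hk
  have hU : ∀ k, evol F (U k) = (tot ^ k) F := by
    intro k
    rw [show evol F (U k) = _ from vecField_eq_sum _ (U k) {k} fun j hj => by
      simp only [Finset.mem_singleton] at hj; simp [pd_U, hj]]
    simp [pd_U]
  have hm : ∀ f g : Jet, evol F (f * g) = f * evol F g + g * evol F f := vecField_mul _
  rw [ht, he, map_sum, map_sum]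
  simp only [hm, tot_mul, hU, pow_succ', Module.End.mul_apply, Finset.sum_add_distrib]
  congr 1
  have e1 : ∀ k, evol F (pd k f) = ∑ i ∈ vars f, pd i (pd k f) * (tot ^ i) F := hs _
  have e2 : ∀ k, tot (pd k f) = ∑ i ∈ vars f, pd i (pd k f) * U (i + 1) := hs _
  simp only [e1, e2, Finset.mul_sum]
  rw [Finset.sum_comm]
  refine Finset.sum_congr rfl fun i _ => Finset.sum_congr rfl fun k _ => ?_
  rw [pd_comm k i]
  ring

/-! ### The kernel of the total derivative -/

/-- The coefficients of `∂f/∂u_k`: a monomial arises from differentiating either the power or the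
logarithm of `u_k`. -/
theorem coeff_pd (k : ℕ) (f : Jet) (a : ℕ →₀ ℚ) (b : ℕ →₀ ℕ) :
    (pd k f).coeff (a - Finsupp.single k 1, b) =
      (a k : ℝ) * f.coeff (a, b) + (b k + 1 : ℝ) * f.coeff (a, b + Finsupp.single k 1) := by
  classical
  induction f using AddMonoidAlgebra.induction_linear with
  | zero => simp
  | add f g hf hg => simp only [map_add, coeff_add, Finsupp.add_apply, hf, hg]; ring
  | single m c =>
    obtain ⟨a', b'⟩ := m
    simp only [pd_single, pdMon, coeff_smul, coeff_add, coeff_single, Finsupp.smul_apply,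
      Finsupp.add_apply, Finsupp.single_apply, Prod.mk.injEq, smul_eq_mul]
    by_cases ha : a' = a
    · subst ha
      by_cases hb : b' = b
      · subst hb
        by_cases h0 : b' k = 0
        · simp [h0, mul_comm]
        · have h1 : b' - Finsupp.single k 1 ≠ b' := fun h => by
            have := DFunLike.congr_fun h k
            simp at this; omega
          simp [h1, mul_comm]
      · by_cases hb1 : b' = b + Finsupp.single k 1
        · subst hb1; simp [mul_comm]
        · have : ¬ (b' - Finsupp.single k 1 = b ∧ b' k ≠ 0) := by
            rintro ⟨h, h0⟩
            apply hb1
            rw [← h, tsub_add_cancel_of_le]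
            rw [Finsupp.single_le_iff]; omega
          by_cases h0 : b' k = 0
          · simp [hb, hb1, h0]
          · have hb2 : b' - Finsupp.single k 1 ≠ b := fun h => this ⟨h, h0⟩
            simp [hb, hb1, hb2]
    · have : a' - Finsupp.single k 1 ≠ a - Finsupp.single k 1 := fun h => ha (sub_left_injective h)
      simp [ha, this]

/-- If all partial derivatives vanish, then `coeff_pd` is a recurrence for the coefficients along
the powers of `log u_k`. A nonzero coefficient at an exponent with `a_k ≠ 0` would give
infinitely many nonzero ones. -/
theorem eq_const_of_pd_eq_zero {f : Jet} (h : ∀ k, pd k f = 0) : f = single 0 (constTerm f) := by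
  have key : ∀ k a b, (a k : ℝ) * f.coeff (a, b) +
      (b k + 1 : ℝ) * f.coeff (a, b + Finsupp.single k 1) = 0 := by
    intro k a b
    rw [← coeff_pd, h k]
    simp
  have ha : ∀ k a b, a k ≠ 0 → f.coeff (a, b) = 0 := by
    intro k a b hak
    by_contra hf
    have hn : ∀ n : ℕ, f.coeff (a, b + n • Finsupp.single k 1) ≠ 0 := by
      intro n
      induction n with
      | zero => simpa using hf
      | succ n ih =>
        intro h0
        have := key k a (b + n • Finsupp.single k 1)
        rw [add_assoc, ← succ_nsmul, h0, mul_zero, add_zero] at this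
        exact (mul_ne_zero (by exact_mod_cast hak) ih) this
    refine Set.not_injOn_infinite_finite_image (s := Set.univ)
      (f := fun n : ℕ => ((a, b + n • Finsupp.single k 1) : Expo)) Set.infinite_univ
      (f.coeff.support.finite_toSet.subset ?_) ?_
    · rintro _ ⟨n, -, rfl⟩
      simpa using hn n
    · intro m _ n _ hmn
      have := DFunLike.congr_fun (Prod.ext_iff.mp hmn).2 k
      simpa using this
  have hb : ∀ k a b, b k ≠ 0 → f.coeff (a, b) = 0 := by
    intro k a b hbk
    by_cases hak : a k = 0
    · have := key k a (b - Finsupp.single k 1)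
      rw [hak, tsub_add_cancel_of_le (by rw [Finsupp.single_le_iff]; omega)] at this
      have hpos : ((b - Finsupp.single k 1 : ℕ →₀ ℕ) k + 1 : ℝ) ≠ 0 := by positivity
      rw [Rat.cast_zero, zero_mul, zero_add] at this
      exact (mul_eq_zero.mp this).resolve_left hpos
    · exact ha k a b hak
  ext ⟨a, b⟩
  rw [coeff_single, Finsupp.single_apply]
  split_ifs with h0
  · rw [← h0]; rfl
  · by_cases hx : a = 0
    · subst hx
      have : b ≠ 0 := fun hb0 => h0 (by rw [hb0]; rfl)
      obtain ⟨k, hk⟩ := Finsupp.ne_iff.mp this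
      exact hb k _ _ hk
    · obtain ⟨k, hk⟩ := Finsupp.ne_iff.mp hx
      exact ha k _ _ hk

/-- The kernel of `∂` consists of the constants: if `u_k` were the highest jet coordinate in `f`,
then `∂f/∂u_k = ∂(∂f)/∂u_{k+1}` would vanish. -/
theorem eq_const_of_tot_eq_zero {f : Jet} (h : tot f = 0) : f = single 0 (constTerm f) := by
  refine eq_const_of_pd_eq_zero fun k => ?_
  by_contra hk
  have hne : (vars f).Nonempty := ⟨k, by by_contra h'; exact hk (pd_eq_zero_of_notMem_vars h')⟩
  set N := (vars f).max' hne
  have h1 : pd (N + 1) f = 0 := pd_eq_zero_of_notMem_vars fun h' => by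
    have := (vars f).le_max' _ h'
    omega
  have h2 := pd_succ_tot N f
  rw [h, h1, map_zero, map_zero, zero_add] at h2
  have h3 : N ∈ vars f := (vars f).max'_mem hne
  simp [vars, ← h2] at h3

/-- A primitive is determined by its constant term. -/
theorem eq_of_tot_eq {f g : Jet} (h : tot f = tot g) (hc : constTerm f = constTerm g) : f = g := by
  have h1 : tot (f - g) = 0 := by rw [map_sub, h, sub_self]
  have h2 : constTerm (f - g) = 0 := by
    simp only [constTerm] at hc ⊢
    simp [hc]
  have := eq_const_of_tot_eq_zero h1
  rw [h2, single_zero] at this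
  exact sub_eq_zero.mp this

/-! ### Powers of the jet coordinates -/

theorem upow_add (k : ℕ) (p q : ℚ) : upow k (p + q) = upow k p * upow k q := by
  rw [upow, Finsupp.single_add, mon_add]; rfl

theorem upow_zero (k : ℕ) : upow k 0 = 1 := by
  rw [upow, Finsupp.single_zero, mon_zero]

theorem tot_upow (k : ℕ) (q : ℚ) :
    tot (upow k q) = (q : ℝ) • (upow k (q - 1) * U (k + 1)) := by
  rw [tot_eq_sum _ {k}, Finset.sum_singleton, upow, pd_mon, ← Finsupp.single_sub]
  · simp [upow]
  · intro j hj
    rw [upow, pd_mon, Finsupp.single_eq_of_ne (by simpa using hj)]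
    simp

theorem tot_U (k : ℕ) : tot (U k) = U (k + 1) := by
  rw [U, tot_upow]; simp [upow_zero]

theorem pd_upow_self (k : ℕ) (q : ℚ) : pd k (upow k q) = (q : ℝ) • upow k (q - 1) := by
  rw [upow, pd_mon, ← Finsupp.single_sub]; simp [upow]

theorem pd_upow_of_ne {j k : ℕ} (h : j ≠ k) (q : ℚ) : pd j (upow k q) = 0 := by
  rw [upow, pd_mon, Finsupp.single_eq_of_ne h]; simp

/-! ### Scaling -/

/-- The degree of a monomial in `u`; logarithms have degree `0`. -/
def degree : Expo →+ ℚ :=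
  (Finsupp.liftAddHom fun _ => AddMonoidHom.id ℚ).comp (AddMonoidHom.fst (ℕ →₀ ℚ) (ℕ →₀ ℕ))

/-- The differential functions all of whose monomials `m` satisfy `c * degree m ≤ t`. With `c = 1`
and `c = -1` these are the functions of degree at most `t` and at least `-t`. For `t < 0` they
have no constant term, which determines the constants of integration. -/
def degLE (c t : ℚ) : Submodule ℝ Jet where
  carrier := {f | ∀ m, f.coeff m ≠ 0 → c * degree m ≤ t}
  zero_mem' := by simp
  add_mem' := by
    intro f g hf hg m hm
    by_cases h : f.coeff m = 0
    · refine hg m fun h' => hm ?_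
      simp [h, h']
    · exact hf m h
  smul_mem' := by
    intro r f hf m hm
    exact hf m fun h => hm (by simp [h])

theorem degLE_mono {c s t : ℚ} (h : s ≤ t) {f : Jet} (hf : f ∈ degLE c s) : f ∈ degLE c t :=
  fun m hm => (hf m hm).trans h

theorem single_mem_degLE {c t : ℚ} {m : Expo} (h : c * degree m ≤ t) (r : ℝ) :
    (single m r : Jet) ∈ degLE c t := by
  classical
  intro n hn
  rw [coeff_single, Finsupp.single_apply] at hn
  split_ifs at hn with hmn
  · exact hmn ▸ h
  · exact absurd rfl hn

theorem induction_degLE {c t : ℚ} {P : Jet → Prop} (h0 : P 0) (ha : ∀ f g, P f → P g → P (f + g))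
    (hs : ∀ (m : Expo) (r : ℝ), c * degree m ≤ t → P (single m r)) {f : Jet}
    (hf : f ∈ degLE c t) : P f := by
  rw [← sum_coeff_single f, Finsupp.sum]
  refine Finset.sum_induction _ P ha h0 fun m hm => hs m _ (hf m (by simpa using hm))

theorem mul_mem_degLE {c s t : ℚ} {f g : Jet} (hf : f ∈ degLE c s) (hg : g ∈ degLE c t) :
    f * g ∈ degLE c (s + t) := by
  refine induction_degLE (P := fun f => f * g ∈ degLE c (s + t)) (by simp)
    (fun f₁ f₂ h₁ h₂ => by rw [add_mul]; exact add_mem h₁ h₂) (fun m r hm => ?_) hf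
  refine induction_degLE (P := fun g => single m r * g ∈ degLE c (s + t)) (by simp)
    (fun f₁ f₂ h₁ h₂ => by rw [mul_add]; exact add_mem h₁ h₂) (fun n r' hn => ?_) hg
  rw [single_mul_single]
  refine single_mem_degLE ?_ _
  rw [map_add]
  linarith

theorem degree_single (k : ℕ) (q : ℚ) (b : ℕ →₀ ℕ) : degree (Finsupp.single k q, b) = q := by
  simp [degree]

theorem upow_mem_degLE {c t : ℚ} (k : ℕ) (q : ℚ) (h : c * q ≤ t) : upow k q ∈ degLE c t :=
  single_mem_degLE (by rwa [degree_single]) 1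

theorem one_mem_degLE {c t : ℚ} (h : 0 ≤ t) : (1 : Jet) ∈ degLE c t :=
  upow_zero 0 ▸ upow_mem_degLE 0 0 (by simpa using h)

theorem pd_mem_degLE {c t : ℚ} {f : Jet} (k : ℕ) (hf : f ∈ degLE c t) :
    pd k f ∈ degLE c (t - c) := by
  refine induction_degLE (P := fun f => pd k f ∈ degLE c (t - c)) (by simp)
    (fun f₁ f₂ h₁ h₂ => by rw [map_add]; exact add_mem h₁ h₂) (fun m r hm => ?_) hf
  have hd : ∀ b : ℕ →₀ ℕ, degree (m.1 - Finsupp.single k 1, b) = degree m - 1 := by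
    intro b
    have h := degree_single k 1 b
    simp only [degree, AddMonoidHom.comp_apply, AddMonoidHom.coe_fst, map_sub] at h ⊢
    rw [h]
  rw [pd_single, pdMon]
  refine Submodule.smul_mem _ _ (add_mem ?_ ?_) <;>
  · refine single_mem_degLE ?_ _
    rw [hd]
    linarith

/-- The total derivative preserves the degree. -/
theorem tot_mem_degLE {c t : ℚ} {f : Jet} (hf : f ∈ degLE c t) : tot f ∈ degLE c t := by
  rw [tot_eq_sum f (vars f) fun k hk => pd_eq_zero_of_notMem_vars hk]
  refine Submodule.sum_mem _ fun k _ => ?_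
  have := mul_mem_degLE (pd_mem_degLE k hf)
    (upow_mem_degLE (c := c) (t := c) (k + 1) 1 (by simp))
  rwa [sub_add_cancel] at this

theorem constTerm_eq_zero_of_mem_degLE {c t : ℚ} (ht : t < 0) {f : Jet} (hf : f ∈ degLE c t) :
    constTerm f = 0 := by
  by_contra h
  have := hf 0 h
  simp at this
  linarith

/-! ### The algebra of operators -/

/-- The ring of endomorphisms of `Symb`, in which formal pseudo-differential operators are compared.
It is a type synonym because it carries the action of `Jet` by multiplication operators from the
left. -/
def PDO : Type := Module.End ℝ Symb

instance : Ring PDO := inferInstanceAs (Ring (Module.End ℝ Symb))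

/-- Multiplication operators, as a ring homomorphism. -/
def mulP : Jet →+* PDO where
  toFun f := mulS f
  map_one' := by
    change mulS 1 = 1
    ext1 a; ext1; funext k; exact one_mul _
  map_mul' f g := by
    change mulS (f * g) = mulS f * mulS g
    ext1 a; ext1; funext k; exact mul_assoc _ _ _
  map_zero' := by
    change mulS 0 = 0
    ext1 a; ext1; funext k; exact zero_mul _
  map_add' f g := by
    change mulS (f + g) = mulS f + mulS g
    ext1 a; ext1; funext k; exact add_mul _ _ _

/-- Operators as a left module over the differential functions. -/
instance : Module Jet PDO := Module.compHom PDO mulP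

instance : IsScalarTower Jet PDO PDO :=
  ⟨fun f S T => mul_assoc (mulP f) S T⟩

/-- The operator `∂`. -/
def dP : PDO := dS

/-- The operator `∂⁻¹`. -/
def eP : PDO := dinvS

/-- A derivation of the differential functions, acting on the coefficients of operators. -/
def derP (X : Derivation ℝ Jet Jet) : PDO := coeffwise X.toLinearMap

theorem smul_def (f : Jet) (T : PDO) : f • T = mulP f * T := rfl

theorem dP_smul (f : Jet) (T : PDO) : dP * (f • T) = f • (dP * T) + tot f • T := by
  have h : dP * mulP f = mulP f * dP + mulP (tot f) := by
    change dS * mulS f = mulS f * dS + mulS (tot f)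
    ext1 a; ext1; funext k
    change f * a.1 (k - 1) + tot (f * a.1 k) = f * (a.1 (k - 1) + tot (a.1 k)) + tot f * a.1 k
    rw [tot_mul]
    ring
  simp only [smul_def, ← mul_assoc, h, add_mul]

theorem derP_smul (X : Derivation ℝ Jet Jet) (f : Jet) (T : PDO) :
    derP X * (f • T) = f • (derP X * T) + X f • T := by
  have h : derP X * mulP f = mulP f * derP X + mulP (X f) := by
    change coeffwise X.toLinearMap * mulS f = mulS f * coeffwise X.toLinearMap + mulS (X f)
    ext1 a; ext1; funext k
    change X (f * a.1 k) = f * X (a.1 k) + X f * a.1 k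
    rw [Derivation.leibniz, smul_eq_mul, smul_eq_mul]
    ring
  simp only [smul_def, ← mul_assoc, h, add_mul]

theorem derP_mul_dP (X : Derivation ℝ Jet Jet) (h : ∀ f, X (tot f) = tot (X f)) :
    derP X * dP = dP * derP X := by
  change coeffwise X.toLinearMap * dS = dS * coeffwise X.toLinearMap
  ext1 a; ext1; funext k
  change X (a.1 (k - 1) + tot (a.1 k)) = X (a.1 (k - 1)) + tot (X (a.1 k))
  rw [map_add, h]

/-- The formal pseudo-differential operator given by an expression. -/
def pdo (T : NOp) : PDO := T.toPDO

theorem pdo_diff (c : ℕ →₀ Jet) : pdo (diff c) = c.sum fun k f => f • dP ^ k := rfl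

theorem pdo_fn (f : Jet) : pdo (fn f) = f • 1 := by
  rw [fn, pdo_diff, Finsupp.sum_single_index] <;> simp

theorem pdo_D : pdo D = dP := by
  rw [D, pdo_diff, Finsupp.sum_single_index] <;> simp

theorem pdo_dinv : pdo dinv = eP := rfl

theorem pdo_add (S T : NOp) : pdo (S + T) = pdo S + pdo T := rfl

theorem pdo_mul (S T : NOp) : pdo (S * T) = pdo S * pdo T := rfl

theorem pdo_fn_mul (f : Jet) (T : NOp) : pdo (fn f * T) = f • pdo T := by
  rw [pdo_mul, pdo_fn, smul_mul_assoc, one_mul]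

theorem pdo_sub (S T : NOp) : pdo (S - T) = pdo S - pdo T := by
  change pdo (S + fn (-1) * T) = _
  rw [pdo_add, pdo_fn_mul, neg_smul, one_smul, sub_eq_add_neg]

theorem pdo_frechet (f : Jet) (s : Finset ℕ) (h : ∀ k, k ∉ s → pd k f = 0) :
    pdo (frechet f) = ∑ k ∈ s, pd k f • dP ^ k := by
  change ((grad f).sum fun k a => a • dP ^ k) = _
  refine Finsupp.sum_of_support_subset _ (fun k hk => ?_) _ (by simp)
  by_contra hks
  exact (Finsupp.mem_support_iff.mp hk) (h k hks)

theorem pdo_Dvar (g : Jet) : pdo (Dvar g) = Ring.inverse g • dP := by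
  rw [Dvar, pdo_fn_mul, pdo_D]

theorem pdo_DvarInv (g : Jet) : pdo (DvarInv g) = eP * (g • 1) := by
  rw [DvarInv, pdo_mul, pdo_fn, pdo_dinv]

/-! ### The action on differential functions -/

theorem apply_diff (c : ℕ →₀ Jet) (f g : Jet) :
    (diff c).Apply f g ↔ g = c.sum fun k a => a * (tot ^ k) f := Iff.rfl

theorem apply_fn (a f g : Jet) : (fn a).Apply f g ↔ g = a * f := by
  rw [fn, apply_diff, Finsupp.sum_single_index] <;> simp

theorem apply_D (f g : Jet) : D.Apply f g ↔ g = tot f := by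
  rw [D, apply_diff, Finsupp.sum_single_index] <;> simp

theorem apply_dinv (f g : Jet) : dinv.Apply f g ↔ tot g = f ∧ constTerm g = 0 := Iff.rfl

theorem apply_frechet (a : Jet) (s : Finset ℕ) (h : ∀ k, k ∉ s → pd k a = 0) (f g : Jet) :
    (frechet a).Apply f g ↔ g = ∑ k ∈ s, pd k a * (tot ^ k) f := by
  rw [frechet, apply_diff]
  have : ((grad a).sum fun k b => b * (tot ^ k) f) = ∑ k ∈ s, pd k a * (tot ^ k) f := by
    refine Finsupp.sum_of_support_subset _ (fun k hk => ?_) _ (by simp)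
    by_contra hks
    exact (Finsupp.mem_support_iff.mp hk) (h k hks)
  rw [this]

theorem apply_add (S T : NOp) (f g : Jet) :
    (S + T).Apply f g ↔ ∃ g₁ g₂, S.Apply f g₁ ∧ T.Apply f g₂ ∧ g = g₁ + g₂ := Iff.rfl

theorem apply_mul (S T : NOp) (f g : Jet) :
    (S * T).Apply f g ↔ ∃ h, T.Apply f h ∧ S.Apply h g := Iff.rfl

theorem apply_sub (S T : NOp) (f g : Jet) :
    (S - T).Apply f g ↔ ∃ g₁ g₂, S.Apply f g₁ ∧ T.Apply f g₂ ∧ g = g₁ - g₂ := by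
  change (S + fn (-1) * T).Apply f g ↔ _
  simp only [apply_add, apply_mul, apply_fn]
  constructor
  · rintro ⟨g₁, _, h₁, ⟨g₂, h₂, rfl⟩, rfl⟩
    exact ⟨g₁, g₂, h₁, h₂, by ring⟩
  · rintro ⟨g₁, g₂, h₁, h₂, rfl⟩
    exact ⟨g₁, _, h₁, ⟨g₂, h₂, rfl⟩, by ring⟩

/-- An operator takes at most one value at each differential function. -/
theorem Apply_unique {T : NOp} {f g g' : Jet} (h : T.Apply f g) (h' : T.Apply f g') : g = g' := by
  induction T generalizing f g g' with
  | diff c => rw [apply_diff] at h h'; rw [h, h']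
  | dinv =>
    rw [apply_dinv] at h h'
    exact eq_of_tot_eq (h.1.trans h'.1.symm) (h.2.trans h'.2.symm)
  | add S T hS hT =>
    obtain ⟨g₁, g₂, h₁, h₂, rfl⟩ := h
    obtain ⟨g₁', g₂', h₁', h₂', rfl⟩ := h'
    rw [hS h₁ h₁', hT h₂ h₂']
  | comp S T hS hT =>
    obtain ⟨k, h₁, h₂⟩ := h
    obtain ⟨k', h₁', h₂'⟩ := h'
    obtain rfl := hT h₁ h₁'
    exact hS h₂ h₂'

theorem apply_iff_eq {T : NOp} {f g : Jet} (h : T.Apply f g) (g' : Jet) :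
    T.Apply f g' ↔ g' = g :=
  ⟨fun h' => Apply_unique h' h, fun h' => h' ▸ h⟩

/-- A hierarchy is determined by its recursion operator and its first member. -/
theorem isHierarchyOf_iff_eq {R : NOp} {f : Jet} {K : ℕ → Jet} (h : IsHierarchyOf R f K)
    (K' : ℕ → Jet) : IsHierarchyOf R f K' ↔ K' = K := by
  refine ⟨fun h' => ?_, fun h' => h' ▸ h⟩
  funext n
  induction n with
  | zero => exact Apply_unique h'.1 h.1
  | succ n ih =>
    have := h'.2.2 n
    rw [ih] at this
    exact Apply_unique this (h.2.2 n)

/-! ### Changes of the independent variable -/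

/-- The derivation `∂_z = g⁻¹ ∂`. -/
def zder (g : Jet) : Derivation ℝ Jet Jet := Ring.inverse g • totD

theorem zder_apply (g f : Jet) : zder g f = dvar g f := rfl

theorem tot_eq_dvar {g : Jet} (hg : IsUnit g) (f : Jet) : tot f = g * dvar g f := by
  rw [dvar, Ring.mul_inverse_cancel_left _ _ hg]

theorem inverse_eq_of_mul_eq_one {f g : Jet} (h : f * g = 1) : Ring.inverse f = g := by
  rw [← Ring.inverse_mul_cancel_left f g (IsUnit.of_mul_eq_one _ h), h, mul_one]

/-- The operators `d = ∂` and `e = ∂⁻¹` in a ring of operators `E` over the differential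
algebra `A` with derivation `δ`. -/
structure IsDPair {A E : Type*} [CommRing A] [Algebra ℝ A] [Ring E] [Module A E]
    (δ : Derivation ℝ A A) (d e : E) : Prop where
  d_smul : ∀ (f : A) (T : E), d * (f • T) = f • (d * T) + δ f • T
  d_mul_e : d * e = 1
  e_mul_d : e * d = 1

theorem isDPair_dP : IsDPair totD dP eP := ⟨dP_smul, dS_mul_dinvS, dinvS_mul_dS⟩

theorem dP_mul_eP : dP * eP = 1 := isDPair_dP.d_mul_e

theorem eP_mul_dP : eP * dP = 1 := isDPair_dP.e_mul_d

theorem isDPair_Dvar {g : Jet} (hg : IsUnit g) :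
    IsDPair (zder g) (pdo (Dvar g)) (pdo (DvarInv g)) where
  d_smul f T := by
    rw [pdo_Dvar, smul_mul_assoc, dP_smul, zder_apply, dvar, smul_add, smul_smul, smul_smul,
      smul_mul_assoc, smul_smul, mul_comm f]
  d_mul_e := by
    rw [pdo_Dvar, pdo_DvarInv, smul_mul_assoc, ← mul_assoc, dP_mul_eP, one_mul, smul_smul,
      Ring.inverse_mul_cancel _ hg, one_smul]
  e_mul_d := by
    rw [pdo_Dvar, pdo_DvarInv, mul_assoc, smul_mul_assoc, one_mul, smul_smul,
      Ring.mul_inverse_cancel _ hg, one_smul, eP_mul_dP]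

theorem dP_eq {g : Jet} (hg : IsUnit g) : dP = g • pdo (Dvar g) := by
  rw [pdo_Dvar, smul_smul, Ring.mul_inverse_cancel _ hg, one_smul]

theorem eP_eq {g : Jet} (hg : IsUnit g) : eP = pdo (DvarInv g) * (Ring.inverse g • 1) := by
  rw [pdo_DvarInv, mul_assoc, smul_mul_assoc, one_mul, smul_smul,
    Ring.mul_inverse_cancel _ hg, one_smul, mul_one]

theorem isUnit_smul_one {f : Jet} (hf : IsUnit f) : IsUnit (f • (1 : PDO)) := by
  have := hf.map mulP
  rw [smul_def, mul_one]
  exact this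

theorem isUnit_dP : IsUnit dP := ⟨⟨dP, eP, dP_mul_eP, eP_mul_dP⟩, rfl⟩

theorem isUnit_eP : IsUnit eP := ⟨⟨eP, dP, eP_mul_dP, dP_mul_eP⟩, rfl⟩

theorem isTransformed_of_mul_eq {T S S' : NOp} (h : IsUnit (pdo T))
    (h' : pdo T * pdo S = pdo S' * pdo T) : IsTransformed T S S' :=
  ⟨h, by
    change pdo T * pdo S * Ring.inverse (pdo T) = pdo S'
    rw [h', mul_assoc, Ring.mul_inverse_cancel _ h, mul_one]⟩

namespace IsDPair

variable {A E : Type*} [CommRing A] [Algebra ℝ A] [Ring E] [Module A E]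
  {δ : Derivation ℝ A A} {d e : E} (H : IsDPair δ d e)
include H

theorem d_e (T : E) : d * (e * T) = T := by rw [← mul_assoc, H.d_mul_e, one_mul]

theorem e_d (T : E) : e * (d * T) = T := by rw [← mul_assoc, H.e_mul_d, one_mul]

/-- Integration by parts `∂⁻¹ f ∂ = f - ∂⁻¹ f'`. -/
theorem e_smul_d (f : A) (T : E) : e * (f • (d * T)) = f • T - e * (δ f • T) := by
  have := congrArg (e * ·) (H.d_smul f T)
  simp only [H.e_d, mul_add] at this
  rw [this]
  abel

/-- `∂⁻¹ f' ∂⁻¹ = f ∂⁻¹ - ∂⁻¹ f`. -/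
theorem e_smul_e (f : A) (T : E) : e * (δ f • (e * T)) = f • (e * T) - e * (f • T) := by
  have := H.e_smul_d f (e * T)
  rw [H.d_e] at this
  rw [this]
  abel

end IsDPair

/-! ### Identities between operators -/

theorem derivation_ofNat {A : Type*} [CommRing A] [Algebra ℝ A] (δ : Derivation ℝ A A) (n : ℕ)
    [n.AtLeastTwo] : δ (OfNat.ofNat n) = 0 := by
  rw [← Nat.cast_ofNat]
  exact δ.map_natCast _

namespace IsDPair

variable {A E : Type*} [CommRing A] [Algebra ℝ A] [Ring E] [Module A E]
  {δ : Derivation ℝ A A} {d e : E} (H : IsDPair δ d e)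
include H

theorem e_smul_smul_d (f g : A) (T : E) :
    e * (f • g • (d * T)) = f • g • T - e * (δ f • g • T) - e * (f • δ g • T) := by
  rw [smul_smul, H.e_smul_d, δ.leibniz, add_smul, mul_add, smul_eq_mul, smul_eq_mul, mul_smul,
    mul_smul, mul_comm g, mul_smul]
  abel

theorem e_smul_smul_smul_d (f g k : A) (T : E) :
    e * (f • g • k • (d * T)) =
      f • g • k • T - e * (δ f • g • k • T) - e * (f • δ g • k • T) - e * (f • g • δ k • T) := by
  rw [smul_smul, H.e_smul_smul_d, δ.leibniz, add_smul, mul_add, smul_eq_mul, smul_eq_mul, mul_smul,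
    mul_smul, mul_comm g, mul_smul, mul_smul]
  abel

/-- A factorised form of the operator `∂² - 2φ∂ - β∂⁻¹α∂`, where `β = s'/s`. -/
theorem factor_mKdV {α β φ s si w : A} (hs : s * si = 1) (hs' : δ s = β * s) (hφ : φ = s * w)
    (hβ : β = α - 2 * φ) :
    s • (d * (si • (e * (si • (d * (s • d - 2 • s • s • (e * (w • d)))))))) =
      d * d - 2 • φ • d - β • (e * (α • d)) := by
  have hsi : ∀ T : E, si • s • T = T := fun T => by rw [smul_smul, mul_comm, hs, one_smul]
  have hδsi : δ si = -(β * si) := by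
    have := congrArg δ hs
    rw [δ.leibniz, hs', δ.map_one_eq_zero, smul_eq_mul, smul_eq_mul] at this
    linear_combination si * this - (δ si + β * si) * hs
  have h1 : d * (s • d - 2 • s • s • (e * (w • d))) =
      s • (d * d + β • d - 2 • φ • d - 4 • δ s • (e * (w • d))) := by
    simp only [mul_sub, mul_smul_comm, H.d_smul, H.d_e, hs', hφ]
    module
  have h2 : e * (d * d + β • d - 2 • φ • d - 4 • δ s • (e * (w • d))) =
      d + e * (α • d) - 4 • s • (e * (w • d)) := by
    have h3 : α • d = β • d - 2 • φ • d + 4 • s • w • d := by rw [hβ, hφ]; module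
    simp only [mul_add, mul_sub, mul_smul_comm, H.e_d, H.e_smul_e, h3]
    abel
  have h4 : ∀ T : E, s • (d * (si • T)) = d * T - β • T := fun T => by
    rw [H.d_smul, hδsi, smul_add, smul_smul, smul_smul, hs, one_smul, sub_eq_add_neg, ← neg_smul]
    congr 2
    linear_combination -β * hs
  rw [h1, hsi, h2, h4]
  simp only [mul_add, mul_sub, mul_smul_comm, H.d_smul, H.d_e, hs', smul_add, smul_sub, hφ, hβ]
  module

variable [IsScalarTower A E E]

/-- With `w' = w²`, the operator `∂² - 2w∂ = w ∂² w⁻¹` intertwines `2∂² - 8w∂⁻¹w∂` and `2∂²`. -/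
theorem intertwine_linear_local {w : A} (h : δ w = w ^ 2) :
    (d * d - 2 • w • d) * (2 • (d * d) - 8 • w • (e * (w • d))) =
      2 • (d * d) * (d * d - 2 • w • d) := by
  simp only [mul_add, sub_mul, mul_sub, smul_mul_assoc, mul_assoc, mul_smul_comm, H.d_smul, H.d_e,
    smul_add, h, δ.leibniz_pow, smul_eq_mul]
  simp only [pow_one, Nat.add_one_sub_one]
  module

/-- The operator `∂ - 2v'∂⁻¹w∂` with `v = -1/w` intertwines `2∂² - 4h∂⁻¹w∂ - 4w∂⁻¹h∂` and `2∂²`,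
where `wh = (log w)''`. The products with two factors `∂⁻¹` are reduced by means of the
primitives `2ww' = (w²)'` and `2w'h = ((w'/w)²)'`. -/
theorem intertwine_linear_nonlocal {w wi : A} (hw : w * wi = 1) {l v₁ h : A}
    (hl : l = δ w * wi) (hv : v₁ = δ w * wi ^ 2) (hh : h = δ l * wi) :
    (d - 2 • v₁ • (e * (w • d))) * (2 • (d * d) - 4 • h • (e * (w • d)) - 4 • w • (e * (h • d))) =
      2 • (d * d) * (d - 2 • v₁ • (e * (w • d))) := by
  have hwl : δ w = l * w := by rw [hl]; linear_combination -δ w * hw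
  have hvl : v₁ = l * wi := by rw [hv, hl]; ring
  have hwi : δ wi = -(l * wi) := by
    have := congrArg δ hw
    rw [δ.leibniz, hwl, δ.map_one_eq_zero, smul_eq_mul, smul_eq_mul] at this
    linear_combination wi * this - (δ wi + l * wi) * hw
  have hwh : w * h = δ l := by rw [hh]; linear_combination δ l * hw
  have hv' : δ v₁ = (δ l - l * l) * wi := by
    rw [hvl, δ.leibniz, hwi, smul_eq_mul, smul_eq_mul]; ring
  have hv'' : δ (δ v₁) = (δ (δ l) - 3 * (l * δ l) + l ^ 3) * wi := by
    rw [hv', δ.leibniz, map_sub, δ.leibniz, hwi]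
    simp only [smul_eq_mul]
    ring
  have hh' : δ h = (δ (δ l) - l * δ l) * wi := by
    rw [hh, δ.leibniz, hwi, smul_eq_mul, smul_eq_mul]; ring
  have c : ∀ (n : ℕ) (f : A) (T : E), (n * f) • T = n • (f • T) := fun n f T => by
    rw [mul_smul, Nat.cast_smul_eq_nsmul]
  have ce : ∀ (n : ℕ) (T : E), e * (n • T) = n • (e * T) := fun n T => mul_smul_comm n e T
  have k1 : 2 • (e * (w • δ w • (e * (h • d)))) =
      w • w • (e * (h • d)) - e * (δ l • w • d) := by
    have h1 : δ (w * w) = (2 : ℕ) * (w * δ w) := by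
      rw [δ.leibniz, smul_eq_mul]; push_cast; ring
    have h2 : w * w * h = δ l * w := by rw [mul_assoc, hwh, mul_comm]
    rw [← ce, smul_smul w, ← c, ← h1, H.e_smul_e, mul_smul, smul_smul (w * w), h2, mul_smul]
  have k2 : 2 • (e * (w • δ h • (e * (w • d)))) =
      (2 * δ l - l * l) • (e * (w • d)) - 2 • (e * (δ l • w • d)) + e * (l • l • w • d) := by
    have h1 : δ ((2 : ℕ) * δ l - l * l) = (2 : ℕ) * (w * δ h) := by
      rw [map_sub, δ.leibniz, δ.leibniz, δ.map_natCast, hh']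
      simp only [smul_eq_mul]
      push_cast
      linear_combination (-2 * δ (δ l) + 2 * (l * δ l)) * hw
    rw [← ce, smul_smul w, ← c, ← h1, H.e_smul_e, sub_smul, sub_smul, mul_sub, sub_smul, c, c, ce,
      mul_smul l l (w • d)]
    module
  have k3 : e * (δ (δ w) • d) = e * (δ l • w • d) + e * (l • l • w • d) := by
    have h1 : δ (δ w) = δ l * w + l * (l * w) := by
      rw [hwl, δ.leibniz, hwl, smul_eq_mul, smul_eq_mul]; ring
    rw [h1, add_smul, mul_add, mul_smul, mul_smul, mul_smul]
  have k4 : e * (w • h • w • d) = e * (δ l • w • d) := by rw [smul_smul w h, hwh]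
  have k5 : e * (w • w • h • d) = e * (δ l • w • d) := by
    rw [smul_smul w h, hwh, smul_comm]
  simp only [mul_add, sub_mul, mul_sub, smul_mul_assoc, mul_assoc, mul_smul_comm, H.d_smul, H.d_e,
    H.e_smul_d, smul_add, smul_sub]
  rw [k3, k4, k5]
  generalize e * (δ l • w • d) = x₁ at *
  generalize e * (l • l • w • d) = x₂ at *
  generalize e * (w • δ h • (e * (w • d))) = x₃ at *
  generalize e * (w • δ w • (e * (h • d))) = x₄ at *
  generalize e * (w • d) = x₅ at *
  generalize e * (h • d) = x₆ at *
  have e1 : ∀ T : E, v₁ • w • T = l • T := fun T => by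
    rw [smul_smul, hvl, mul_assoc, mul_comm wi, hw, mul_one]
  have e2 : ∀ T : E, h • w • T = δ l • T := fun T => by rw [smul_smul, mul_comm, hwh]
  have e3 : ∀ T : E, δ v₁ • w • T = (δ l - l * l) • T := fun T => by
    rw [smul_smul, hv', mul_assoc, mul_comm wi, hw, mul_one]
  have k1' : 2 • v₁ • x₄ = (l * w) • x₆ - v₁ • x₁ := by
    rw [smul_comm, k1, smul_sub, e1, smul_smul]
  have k2' : 2 • v₁ • x₃ = v₁ • ((2 * δ l - l * l) • x₅) - 2 • v₁ • x₁ + v₁ • x₂ := by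
    rw [smul_comm, k2, smul_add, smul_sub, smul_comm v₁ 2 x₁]
  have e4 : ∀ T : E, v₁ • l • w • T = l • l • T := fun T => by rw [smul_comm, e1]
  rw [smul_comm w h d, hwl, mul_smul l w d]
  simp only [e1, e2, e3, e4]
  rw [hv'', hh', hvl] at *
  linear_combination (norm := module) 4 • k1' + 4 • k2'

/-- The operator `∂² - 2φ∂ - β∂⁻¹α∂` with `φ' = φ(α - φ)` and `β = α - 2φ` intertwines the operators
`∂² - α∂⁻¹α∂` and `∂² - β∂⁻¹β∂`. The reason is the relation `α² - β² = 4φ'`. -/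
theorem intertwine_mKdV {α β φ : A} (hφ : δ φ = φ * (α - φ)) (hβ : β = α - 2 * φ) :
    (d * d - 2 • φ • d - β • (e * (α • d))) * (d * d - α • (e * (α • d))) =
      (d * d - β • (e * (β • d))) * (d * d - 2 • φ • d - β • (e * (α • d))) := by
  have hβ' : δ β = δ α - 2 * δ φ := by
    rw [hβ, map_sub, δ.leibniz, derivation_ofNat]; simp
  have hφ' : δ (δ φ) = δ φ * α + δ β * φ := by
    rw [hφ, δ.leibniz, map_sub, hβ', smul_eq_mul, smul_eq_mul, hφ]
    ring
  have c : ∀ (n : ℕ) (f : A) (T : E), (n * f) • T = n • (f • T) := fun n f T => by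
    rw [mul_smul, Nat.cast_smul_eq_nsmul]
  have ce : ∀ (n : ℕ) (T : E), e * (n • T) = n • (e * T) := fun n T => mul_smul_comm n e T
  have k1 : e * (α • δ α • (e * (α • d))) = e * (β • δ β • (e * (α • d))) +
      2 • (δ φ • (e * (α • d)) - e * (δ φ • (α • d))) := by
    have h1 : α * δ α = β * δ β + (2 : ℕ) * δ (δ φ) := by
      rw [hφ', hβ', hφ, hβ]
      push_cast
      ring
    rw [smul_smul, h1, add_smul, mul_add, mul_smul, c, ce, H.e_smul_e]
  have k2 : e * (α • α • α • d) = e * (β • β • α • d) + 4 • (e * (δ φ • α • d)) := by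
    have h1 : α * α = β * β + (4 : ℕ) * δ φ := by rw [hφ, hβ]; push_cast; ring
    rw [smul_smul, h1, add_smul, mul_add, mul_smul, c, ce]
  have k3 : e * (δ (δ α) • d) = e * (δ (δ β) • d) + 2 • (e * (δ φ • α • d)) +
      2 • (e * (δ β • φ • d)) := by
    have h1 : δ (δ α) = δ (δ β) + (2 : ℕ) * (δ φ * α) + (2 : ℕ) * (δ β * φ) := by
      rw [hβ', map_sub, δ.leibniz, derivation_ofNat, smul_zero, add_zero, smul_eq_mul, hφ', hβ']
      push_cast
      ring
    rw [h1, add_smul, add_smul, mul_add, mul_add, c, c, ce, ce, mul_smul, mul_smul]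
  simp only [mul_add, sub_mul, mul_sub, smul_mul_assoc, mul_assoc, mul_smul_comm, H.d_smul, H.d_e,
    H.e_smul_d, H.e_smul_smul_d, smul_add, smul_sub]
  rw [k1, k2, k3]
  generalize e * (β • δ β • (e * (α • d))) = x₁
  generalize e * (δ (δ β) • d) = x₂
  generalize e * (β • β • α • d) = x₃
  generalize e * (δ φ • α • d) = x₄
  generalize e * (δ β • φ • d) = x₅
  generalize e * (β • δ φ • d) = x₆
  have hβ'' : δ (δ β) = δ (δ α) - 2 * (δ φ * α + δ β * φ) := by
    rw [hβ', map_sub, δ.leibniz, derivation_ofNat, smul_zero, add_zero, smul_eq_mul, hφ', hβ']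
  rw [hβ'', hφ', hβ', hφ, hβ]
  module

/-- The mKdV recursion operator commutes with the linearised flow, multiplied by `32`; `V` is the
derivative along the flow, acting on the coefficients of operators. -/
theorem commute_mKdV {a : A} {V : E} {X : Derivation ℝ A A}
    (hV : ∀ (f : A) (T : E), V * (f • T) = f • (V * T) + X f • T) (hVd : V * d = d * V)
    (hX : X a = 8 • δ (δ (δ a)) - 3 • (a * (a * δ a))) :
    Commute (V - (8 • (d * (d * d)) - 3 • a • a • d)) (4 • (d * d) - a • (e * (a • d))) := by
  have hVe : V * e = e * V := by
    have h1 := congrArg (fun T => e * T * e) hVd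
    simp only [mul_assoc, H.d_mul_e, H.e_d, mul_one] at h1
    exact h1.symm
  have ce : ∀ T : E, V * (e * T) = e * (V * T) := fun T => by rw [← mul_assoc, hVe, mul_assoc]
  have cd : ∀ T : E, V * (d * T) = d * (V * T) := fun T => by rw [← mul_assoc, hVd, mul_assoc]
  rw [commute_iff_eq]
  simp only [mul_add, sub_mul, mul_sub, smul_mul_assoc, mul_assoc, mul_smul_comm, H.d_smul, H.d_e,
    H.e_smul_d, H.e_smul_smul_smul_d, smul_add, smul_sub, hV, ce, cd, hVd, hX,
    sub_smul, smul_assoc, mul_smul, smul_comm a (δ a)]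
  module

end IsDPair

/-! ### Powers of monomials -/

theorem upow_mul_neg (k : ℕ) (q : ℚ) : upow k q * upow k (-q) = 1 := by
  rw [← upow_add, add_neg_cancel, upow_zero]

theorem upow_pow (k : ℕ) (q : ℚ) (n : ℕ) : upow k q ^ n = upow k (n * q) := by
  induction n with
  | zero => simp [upow_zero]
  | succ n ih => rw [pow_succ, ih, ← upow_add]; push_cast; ring_nf

theorem tot_upow_int (k : ℕ) (n : ℤ) {q : ℚ} (h : q = n) :
    tot (upow k q) = n * (upow k (q - 1) * U (k + 1)) := by
  rw [tot_upow, h, Rat.cast_intCast, Int.cast_smul_eq_zsmul, zsmul_eq_mul]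

theorem isUnit_upow (k : ℕ) (q : ℚ) : IsUnit (upow k q) := IsUnit.of_mul_eq_one _ (upow_mul_neg k q)

theorem rpow_eq (q : ℚ) : rpow q = upow 2 q * upow 1 (-4 * q) := by
  rw [rpow, upow, upow, ← mon_add, rExp, smul_sub, sub_eq_add_neg]
  congr 2
  · simp
  · rw [Finsupp.smul_single, ← Finsupp.single_neg]
    congr 1
    simp [mul_comm]

theorem rpow_add (p q : ℚ) : rpow (p + q) = rpow p * rpow q := by
  rw [rpow, add_smul, mon_add]; rfl

theorem rpow_zero : rpow 0 = 1 := by rw [rpow, zero_smul, mon_zero]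

/-! ### Operators in a new independent variable -/

theorem pdo_changeOp (g q : Jet) :
    pdo (changeOp g q) = pdo (frechet q) - dvar g q • (eP * pdo (frechet g)) := by
  rw [changeOp, pdo_sub, pdo_fn_mul, pdo_mul, pdo_dinv]
  rfl

theorem eP_smul {g : Jet} (hg : IsUnit g) (f : Jet) (T : PDO) :
    eP * (f • T) = pdo (DvarInv g) * ((Ring.inverse g * f) • T) := by
  rw [eP_eq hg, mul_assoc, smul_mul_assoc, one_mul, smul_smul]

theorem eP_smul_dP {g : Jet} (hg : IsUnit g) (f : Jet) :
    eP * (f • dP) = pdo (DvarInv g) * (f • pdo (Dvar g)) := by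
  rw [eP_smul hg, dP_eq hg, smul_smul, mul_right_comm, Ring.inverse_mul_cancel _ hg, one_mul]

/-- The principal part `(g⁻² ∂ + ∂ g⁻²) ∂` of the recursion operators is `2∂_z²`. -/
theorem pdo_principal {g : Jet} (hg : IsUnit g) {f : Jet} (hf : f = Ring.inverse g ^ 2) :
    (f • dP + dP * (f • 1)) * dP = 2 • (pdo (Dvar g) * pdo (Dvar g)) := by
  have h1 : dvar g f * g + f * dvar g g = - (f * dvar g g) := by
    have h2 : tot (Ring.inverse g * g) = 0 := by
      rw [Ring.inverse_mul_cancel _ hg]; exact totD.map_one_eq_zero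
    rw [tot_mul] at h2
    rw [dvar, dvar, hf, sq, tot_mul]
    linear_combination 2 * Ring.inverse g ^ 2 * h2
  have h2 : f * g * g = 1 := by
    have := Ring.inverse_mul_cancel _ hg
    rw [hf]
    linear_combination (Ring.inverse g * g + 1) * this
  have H := isDPair_Dvar hg
  rw [dP_eq hg]
  simp only [add_mul, smul_mul_assoc, mul_assoc, one_mul, H.d_smul, smul_add, smul_smul,
    zder_apply]
  match_scalars
  · linear_combination 2 * h2
  · linear_combination g * h1

theorem pdo_nonlocal {g : Jet} (hg : IsUnit g) (a b : Jet) :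
    a • (eP * (b • (1 : PDO))) * dP = a • (pdo (DvarInv g) * (b • pdo (Dvar g))) := by
  rw [smul_mul_assoc, mul_assoc, smul_mul_assoc, one_mul, eP_smul_dP hg]

theorem pdo_pmKdVOp {g : Jet} (hg : IsUnit g) (p : Jet) :
    pdo (pmKdVOp g p) = 4 • (pdo (Dvar g) * pdo (Dvar g)) -
      dvar g p • (pdo (DvarInv g) * (dvar g p • pdo (Dvar g))) := by
  have h := (isDPair_Dvar hg).e_smul_d (dvar g p) 1
  rw [mul_one, zder_apply] at h
  rw [pmKdVOp, pdo_add, pdo_sub, pdo_fn_mul, pdo_fn, pdo_fn_mul, pdo_mul, pdo_mul, pdo_fn, h,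
    ofNat_smul_eq_nsmul, smul_sub, smul_smul, sq]
  abel

/-! ### The recursion operator of the potential mKdV equation -/

theorem isRecursionOperator_pmKdV : IsRecursionOperator (pmKdVOp 1 (U 0)) pmKdVFlow := by
  have hF : ∀ k, k ∉ ({1, 3} : Finset ℕ) → pd k pmKdVFlow = 0 := by
    intro k hk
    simp only [Finset.mem_insert, Finset.mem_singleton, not_or] at hk
    simp [pmKdVFlow, pd_U, hk.1, hk.2, Derivation.leibniz_pow]
  have hc : ∀ (n : ℕ) (r : ℝ) (f : Jet), n • r • f = ((n : ℝ) * r) • f := fun n r f => by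
    rw [← Nat.cast_smul_eq_nsmul ℝ, smul_smul]
  -- `PDO` is a module over `Jet`, not over `ℝ`; the factor `32` clears the real denominators.
  have hFr : 32 • pdo (frechet pmKdVFlow) = 8 • (dP * (dP * dP)) - 3 • U 1 • U 1 • dP := by
    have h1 : (32 : ℕ) • (pd 1 pmKdVFlow : Jet) = -((3 : ℕ) • (U 1 * U 1 : Jet)) := by
      rw [pmKdVFlow, map_sub, Derivation.map_smul, Derivation.map_smul, Derivation.leibniz_pow,
        pd_U, pd_U, smul_sub, hc, hc]
      norm_num
      exact Or.inl (sq _)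
    have h3 : (32 : ℕ) • (pd 3 pmKdVFlow : Jet) = (8 : ℕ) • (1 : Jet) := by
      rw [pmKdVFlow, map_sub, Derivation.map_smul, Derivation.map_smul, Derivation.leibniz_pow,
        pd_U, pd_U, smul_sub, hc, hc]
      norm_num
      rw [← Nat.cast_ofNat, Nat.cast_smul_eq_nsmul, nsmul_eq_mul, mul_one]
      simp
    rw [pdo_frechet _ _ hF, Finset.sum_pair (by norm_num), smul_add, ← smul_assoc, ← smul_assoc,
      h1, h3, neg_smul, smul_assoc, smul_assoc, one_smul, mul_smul, pow_one, pow_succ', sq]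
    abel
  have hX : 32 • evol pmKdVFlow (U 1) =
      8 • tot (tot (tot (U 1))) - 3 • (U 1 * (U 1 * tot (U 1))) := by
    have h1 : evol pmKdVFlow (U 1) = tot pmKdVFlow := by
      refine (vecField_eq_sum _ (U 1) {1} fun j hj => ?_).trans ?_
      · simp only [Finset.mem_singleton] at hj; simp [pd_U, hj]
      · simp [pd_U]
    have h3 : totD (U 1 ^ 3) = 3 * U 1 ^ 2 * tot (U 1) := by
      rw [Derivation.leibniz_pow, totD_apply]
      simp
      ring
    rw [totD_apply] at h3
    rw [h1, pmKdVFlow, map_sub, map_smul, map_smul, h3, smul_sub, hc, hc]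
    simp only [tot_U]
    norm_num
    rw [← Nat.cast_ofNat, Nat.cast_smul_eq_nsmul, nsmul_eq_mul]
    push_cast
    ring
  let X : Derivation ℝ Jet Jet := vecDer fun k => (tot ^ k) pmKdVFlow
  have key := isDPair_dP.commute_mKdV (a := U 1) (V := 32 • derP X) (X := 32 • X)
    (fun f T => by
      rw [smul_mul_assoc, smul_mul_assoc, derP_smul, smul_add, smul_comm f, Derivation.smul_apply,
        smul_assoc])
    (by rw [smul_mul_assoc, mul_smul_comm, derP_mul_dP X (evol_tot pmKdVFlow)]) hX
  rw [← hFr, ← smul_sub] at key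
  have hR : pdo (pmKdVOp 1 (U 0)) = 4 • (dP * dP) - U 1 • (eP * (U 1 • dP)) := by
    rw [pdo_pmKdVOp isUnit_one, pdo_Dvar, pdo_DvarInv, dvar, Ring.inverse_one, one_mul, one_smul,
      one_smul, mul_one, tot_U]
  rw [← hR] at key
  change Commute (derP X - pdo (frechet pmKdVFlow)) (pdo (pmKdVOp 1 (U 0)))
  rw [commute_iff_eq, smul_mul_assoc, mul_smul_comm] at key
  have h32 : (algebraMap ℝ Jet (1 / 32)) * (32 : ℕ) = 1 := by
    rw [← map_natCast (algebraMap ℝ Jet), ← map_mul]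
    norm_num only
    exact map_one _
  have hcancel : ∀ T : PDO, algebraMap ℝ Jet (1 / 32) • (32 • T) = T := fun T => by
    rw [← Nat.cast_smul_eq_nsmul Jet, smul_smul, h32, one_smul]
  have := congrArg (algebraMap ℝ Jet (1 / 32) • ·) key
  simp only [hcancel] at this
  exact this

/-! ### The variables `(y, v)` -/

theorem U_eq (k : ℕ) : U k = upow k 1 := rfl

theorem w_mul_inv : U 1 * upow 1 (-1) = 1 := upow_mul_neg 1 1

theorem gy_mul_inv : gy * upow 1 (-2) = 1 := by
  rw [gy, U, upow_pow]; norm_num [← upow_add, upow_zero]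

theorem isUnit_gy : IsUnit gy := IsUnit.of_mul_eq_one _ gy_mul_inv

theorem inverse_gy : Ring.inverse gy = upow 1 (-2) := inverse_eq_of_mul_eq_one gy_mul_inv

theorem tot_v : tot v = upow 1 (-2) * U 2 := by
  rw [v, map_neg, tot_upow]; norm_num

theorem frechet_w : pdo (frechet w) = dP := by
  rw [pdo_frechet w {1} fun k hk => by
    simp only [Finset.mem_singleton] at hk; simp [w, pd_U, hk]]
  simp [w, pd_U]

theorem frechet_gy : pdo (frechet gy) = 2 • U 1 • dP := by
  rw [pdo_frechet gy {1} fun k hk => by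
    simp only [Finset.mem_singleton] at hk; simp [gy, pd_U, hk, Derivation.leibniz_pow]]
  have : (pd 1 gy : Jet) = 2 • U 1 := by simp [gy, pd_U, Derivation.leibniz_pow]
  rw [Finset.sum_singleton, this, smul_assoc, pow_one]

theorem frechet_v : pdo (frechet v) = upow 1 (-2) • dP := by
  rw [pdo_frechet v {1} fun k hk => by
    simp only [Finset.mem_singleton] at hk; simp [v, pd_upow_of_ne hk]]
  rw [Finset.sum_singleton, v, map_neg, pd_upow_self, pow_one]
  norm_num

theorem changeOp_w : pdo (changeOp gy w) =
    pdo (fn w * (D * (fn (upow 1 (-2)) * (dinv * (fn w * D))))) := by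
  have h1 : U 1 * upow 1 (-2) * U 1 = 1 := by rw [← gy_mul_inv, gy]; ring
  have h2 : U 1 * upow 1 (-3) = upow 1 (-2) := by rw [U_eq, ← upow_add]; norm_num
  have h3 : tot (upow 1 (-2)) = -2 * (upow 1 (-3) * U 2) := by
    rw [tot_upow_int 1 (-2 : ℤ)] <;> norm_num
  rw [pdo_changeOp, frechet_w, frechet_gy, pdo_fn_mul, pdo_mul D, pdo_fn_mul, pdo_mul dinv,
    pdo_fn_mul, pdo_dinv, pdo_D, dP_smul, isDPair_dP.d_e, h3, dvar, inverse_gy, mul_smul_comm, w,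
    tot_U, ← h2]
  rw [← h2] at h1
  match_scalars
  · linear_combination -h1
  · ring

theorem changeOp_v : pdo (changeOp gy v) = upow 1 (-2) • pdo (changeOp gy w) := by
  rw [pdo_changeOp, pdo_changeOp, frechet_v, frechet_w, dvar, dvar, tot_v, inverse_gy, w, tot_U,
    smul_sub, smul_smul]

theorem isUnit_changeOp_w : IsUnit (pdo (changeOp gy w)) := by
  rw [changeOp_w, pdo_mul, pdo_mul, pdo_mul, pdo_mul, pdo_mul, pdo_fn, pdo_fn, pdo_D, pdo_dinv]
  have hw : IsUnit w := isUnit_upow 1 1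
  exact (isUnit_smul_one hw).mul (isUnit_dP.mul ((isUnit_smul_one (isUnit_upow _ _)).mul
    (isUnit_eP.mul ((isUnit_smul_one hw).mul isUnit_dP))))

theorem isUnit_changeOp_v : IsUnit (pdo (changeOp gy v)) := by
  rw [changeOp_v, ← one_mul (pdo (changeOp gy w)), ← smul_mul_assoc]
  exact (isUnit_smul_one (isUnit_upow _ _)).mul isUnit_changeOp_w

/-- The operator `D_v` in terms of any independent variable `z` with `∂z/∂x = g`. -/
theorem changeOp_v_eq {g : Jet} (hg : IsUnit g) : pdo (changeOp gy v) =
    (upow 1 (-2) * g) • pdo (Dvar g) -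
      2 • rpow 1 • (pdo (DvarInv g) * (U 1 • pdo (Dvar g))) := by
  have h1 : dvar gy v = rpow 1 := dvar_v
  rw [pdo_changeOp, frechet_v, frechet_gy, h1, mul_smul_comm, eP_smul_dP hg, dP_eq hg, smul_smul,
    smul_comm (rpow 1) 2]

theorem pdo_mul_Dvar (g : Jet) (n : ℕ) [n.AtLeastTwo] :
    pdo (fn (OfNat.ofNat n) * (Dvar g * Dvar g)) =
      (OfNat.ofNat n : ℕ) • (pdo (Dvar g) * pdo (Dvar g)) := by
  rw [pdo_fn_mul, pdo_mul, ofNat_smul_eq_nsmul]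

/-- `w h = ∂_y² log w`. -/
theorem h3_eq : h3 = dvar gy (dvar gy (U 1) * upow 1 (-1)) * upow 1 (-1) := by
  have h1 : dvar gy (U 1) * upow 1 (-1) = upow 1 (-3) * U 2 := by
    rw [dvar, inverse_gy, tot_U, mul_right_comm, ← upow_add]; norm_num
  have h2 : tot (upow 1 (-3)) = -3 * (upow 1 (-4) * U 2) := by
    rw [tot_upow_int 1 (-3 : ℤ)] <;> norm_num
  have h4 : U 2 * U 2 = upow 2 2 := by rw [U_eq, ← upow_add]; norm_num
  have h5 : upow 1 (-6) = upow 1 (-2) * upow 1 (-1) * upow 1 (-3) := by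
    simp only [← upow_add]; norm_num
  have h6 : upow 1 (-7) = upow 1 (-2) * upow 1 (-1) * upow 1 (-4) := by
    simp only [← upow_add]; norm_num
  rw [h1, dvar, inverse_gy, tot_mul, tot_U, h2, h3, ← h4, h5, h6]
  ring

theorem coeff_R3 : upow 1 (-4) = Ring.inverse gy ^ 2 := by
  rw [inverse_gy, upow_pow]; norm_num

theorem isTransformed_R3 :
    IsTransformed (changeOp gy v) R3 (fn 2 * (Dvar gy * Dvar gy)) := by
  refine isTransformed_of_mul_eq isUnit_changeOp_v ?_
  have hR : pdo R3 = 2 • (pdo (Dvar gy) * pdo (Dvar gy)) -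
      4 • h3 • (pdo (DvarInv gy) * (U 1 • pdo (Dvar gy))) -
      4 • U 1 • (pdo (DvarInv gy) * (h3 • pdo (Dvar gy))) := by
    rw [R3, pdo_mul, pdo_sub, pdo_sub, pdo_add, pdo_fn_mul, pdo_mul, pdo_fn_mul, pdo_fn_mul,
      pdo_mul, pdo_mul, pdo_dinv, pdo_D, sub_mul, sub_mul, pdo_fn, pdo_fn, pdo_fn,
      pdo_principal isUnit_gy coeff_R3, pdo_nonlocal isUnit_gy, pdo_nonlocal isUnit_gy, mul_smul,
      mul_smul]
    simp only [ofNat_smul_eq_nsmul]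
  have h1 : upow 1 (-2) * gy = 1 := by rw [mul_comm, gy_mul_inv]
  have h2 : rpow 1 = zder gy (U 1) * upow 1 (-1) ^ 2 := by
    rw [zder_apply, dvar, inverse_gy, tot_U, upow_pow, mul_right_comm, ← upow_add, rpow_eq, U_eq]
    norm_num [mul_comm]
  rw [hR, pdo_mul_Dvar, changeOp_v_eq isUnit_gy, h1, one_smul]
  exact (isDPair_Dvar isUnit_gy).intertwine_linear_nonlocal w_mul_inv rfl h2 h3_eq

/-! ### Inverses and operators of second order -/

theorem pd_upow_int (k : ℕ) (n : ℤ) {q : ℚ} (h : q = n) :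
    pd k (upow k q) = n * upow k (q - 1) := by
  rw [pd_upow_self, h, Rat.cast_intCast, Int.cast_smul_eq_zsmul, zsmul_eq_mul]

theorem frechet_pair {f : Jet} (h : ∀ k, k ∉ ({1, 2} : Finset ℕ) → pd k f = 0) :
    pdo (frechet f) = pd 1 f • dP + pd 2 f • (dP * dP) := by
  rw [pdo_frechet _ _ h, Finset.sum_pair (by norm_num), pow_one, sq]

theorem apply_frechet_pair {a : Jet} (h : ∀ k, k ∉ ({1, 2} : Finset ℕ) → pd k a = 0) (f g : Jet) :
    (frechet a).Apply f g ↔ g = pd 1 a * tot f + pd 2 a * tot (tot f) := by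
  rw [apply_frechet _ _ h, Finset.sum_pair (by norm_num), pow_one, sq, Module.End.mul_apply]

theorem pd_upow_mul_upow {p q : ℚ} {k : ℕ} (hk : k ∉ ({1, 2} : Finset ℕ)) :
    pd k (upow 1 p * upow 2 q) = 0 := by
  simp only [Finset.mem_insert, Finset.mem_singleton, not_or] at hk
  rw [Derivation.leibniz, pd_upow_of_ne hk.1, pd_upow_of_ne hk.2, smul_zero, smul_zero, add_zero]

theorem dP_mul_dP {g : Jet} (hg : IsUnit g) : dP * dP =
    g • g • (pdo (Dvar g) * pdo (Dvar g)) + g • dvar g g • pdo (Dvar g) := by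
  rw [dP_eq hg, smul_mul_assoc, (isDPair_Dvar hg).d_smul, smul_add, zder_apply]

theorem upow_natCast (k n : ℕ) : upow k n = U k ^ n := by
  rw [U, upow_pow, mul_one]

theorem upow_neg_two (k : ℕ) : upow k (-2) = upow k (-1) ^ 2 := by
  rw [upow_pow]; norm_num

theorem tot_inv (k : ℕ) : tot (upow k (-1)) = -(upow k (-1) ^ 2 * U (k + 1)) := by
  rw [tot_upow_int k (-1 : ℤ) (by norm_num), upow_pow]; norm_num

theorem pd_inv (k : ℕ) : pd k (upow k (-1)) = -(upow k (-1) ^ 2) := by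
  rw [pd_upow_int k (-1 : ℤ) (by norm_num), upow_pow]; norm_num

theorem tot_pow (f : Jet) (n : ℕ) : tot (f ^ n) = n * f ^ (n - 1) * tot f := by
  have := totD.leibniz_pow f n
  rw [totD_apply, totD_apply, smul_eq_mul, nsmul_eq_mul] at this
  rw [this, mul_assoc]

/-! ### The variables `(v, -1/r)` -/

theorem gz2_eq : gz2 = upow 1 (-1) ^ 2 * U 2 := by
  rw [gz2, tot_v, upow_pow]; norm_num

theorem u2_mul_inv : U 2 * upow 2 (-1) = 1 := upow_mul_neg 2 1

theorem gz2_mul_inv : gz2 * (U 1 ^ 2 * upow 2 (-1)) = 1 := by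
  have h1 := w_mul_inv
  have h2 := u2_mul_inv
  rw [gz2_eq]
  grind

theorem isUnit_gz2 : IsUnit gz2 := IsUnit.of_mul_eq_one _ gz2_mul_inv

theorem inverse_gz2 : Ring.inverse gz2 = U 1 ^ 2 * upow 2 (-1) :=
  inverse_eq_of_mul_eq_one gz2_mul_inv

theorem p2_eq : p2 = -(U 1 ^ 4 * upow 2 (-1)) := by
  rw [p2, rpow_eq, ← upow_natCast]; norm_num [mul_comm]

theorem dvar_gz2_w : dvar gz2 (U 1) = U 1 ^ 2 := by
  rw [dvar, inverse_gz2, tot_U, mul_assoc, mul_comm (upow 2 (-1)), u2_mul_inv, mul_one]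

theorem dvar_p2 : dvar gz2 p2 =
    U 1 ^ 6 * upow 2 (-1) ^ 3 * U 3 - 4 * (U 1 ^ 5 * upow 2 (-1)) := by
  have h2 := u2_mul_inv
  rw [dvar, inverse_gz2, p2_eq, map_neg, tot_mul, tot_pow, tot_inv, tot_U]
  push_cast
  norm_num
  grind

theorem p2_eq_upow : p2 = -(upow 1 4 * upow 2 (-1)) := by
  rw [p2_eq, ← upow_natCast]; norm_num

theorem pd_p2_eq_zero {k : ℕ} (hk : k ∉ ({1, 2} : Finset ℕ)) : pd k p2 = 0 := by
  rw [p2_eq_upow, map_neg, pd_upow_mul_upow hk, neg_zero]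

theorem pd_one_p2 : pd 1 p2 = -(4 * (U 1 ^ 3 * upow 2 (-1))) := by
  have h : pd 1 (upow 1 4) = 4 * U 1 ^ 3 := by
    rw [pd_upow_int 1 (4 : ℤ) (by norm_num), ← upow_natCast]; norm_num
  rw [p2_eq_upow, map_neg, Derivation.leibniz, h, pd_upow_of_ne (by norm_num)]
  simp only [smul_eq_mul]
  ring

theorem pd_two_p2 : pd 2 p2 = U 1 ^ 4 * upow 2 (-1) ^ 2 := by
  have h : upow 1 4 = U 1 ^ 4 := by rw [← upow_natCast]; norm_num
  rw [p2_eq_upow, map_neg, Derivation.leibniz, pd_inv, pd_upow_of_ne (by norm_num), h]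
  simp only [smul_eq_mul]
  ring

theorem gz2_eq_upow : gz2 = upow 1 (-2) * upow 2 1 := by rw [gz2, tot_v, U_eq]

theorem pd_gz2_eq_zero {k : ℕ} (hk : k ∉ ({1, 2} : Finset ℕ)) : pd k gz2 = 0 := by
  rw [gz2_eq_upow, pd_upow_mul_upow hk]

theorem pd_one_gz2 : pd 1 gz2 = tot (upow 1 (-2)) := by
  rw [gz2_eq_upow, Derivation.leibniz, pd_upow_int 1 (-2 : ℤ) (by norm_num),
    pd_upow_of_ne (by norm_num), tot_upow_int 1 (-2 : ℤ) (by norm_num), U_eq]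
  simp only [smul_eq_mul]
  ring

theorem pd_two_gz2 : pd 2 gz2 = upow 1 (-2) := by
  rw [gz2_eq_upow, Derivation.leibniz, ← U_eq, pd_U, pd_upow_of_ne (by norm_num), if_pos rfl]
  simp only [smul_eq_mul]
  ring

theorem changeOp_p2 : pdo (changeOp gz2 p2) =
    pdo (Dvar gz2) * pdo (Dvar gz2) - 2 • U 1 • pdo (Dvar gz2) := by
  have h1 := w_mul_inv
  have h2 := u2_mul_inv
  have hδ : dvar gz2 gz2 = U 3 * upow 2 (-1) - 2 * (U 1 ^ 2 * upow 1 (-1) ^ 3 * U 2) := by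
    rw [dvar, inverse_gz2, gz2_eq, tot_mul, tot_pow, tot_inv, tot_U]
    push_cast
    norm_num
    grind
  have hg : pdo (frechet gz2) = dP * (upow 1 (-2) • dP) := by
    rw [frechet_pair fun k hk => pd_gz2_eq_zero hk, dP_smul, pd_one_gz2, pd_two_gz2, add_comm]
  rw [pdo_changeOp, frechet_pair fun k hk => pd_p2_eq_zero hk, pd_one_p2, pd_two_p2, hg,
    isDPair_dP.e_d, dvar_p2, dP_mul_dP isUnit_gz2, dP_eq isUnit_gz2, hδ,
    upow_neg_two]
  generalize pdo (Dvar gz2) = d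
  rw [gz2_eq]
  match_scalars
  · grind
  · grind

theorem changeOp_p2_eq_factor : pdo (changeOp gz2 p2) =
    pdo (fn (p2 ^ 2) * (fn (rpow 2) * (Dvar gz2 * fn (rpow (-1)))) * changeOp gy v) := by
  have h1 := w_mul_inv
  have h2 := u2_mul_inv
  have H := isDPair_Dvar isUnit_gz2
  have hp : p2 ^ 2 * rpow 2 = 1 := by
    rw [p2, neg_sq, sq, ← rpow_add, ← rpow_add]; norm_num [rpow_zero]
  have hr : rpow 1 = upow 1 (-1) ^ 4 * U 2 := by
    rw [rpow_eq, upow_pow, U_eq 2]; norm_num [mul_comm]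
  have hr' : rpow 1 = upow 1 (-2) * gz2 := by
    rw [hr, gz2_eq, upow_neg_two]; ring
  have hri : rpow (-1) * rpow 1 = 1 := by rw [← rpow_add]; norm_num [rpow_zero]
  rw [pdo_mul, pdo_fn_mul, pdo_fn_mul, pdo_mul, pdo_fn, smul_smul, hp, one_smul,
    changeOp_v_eq isUnit_gz2, ← hr', mul_assoc, smul_mul_assoc, one_mul, smul_sub, smul_smul, hri,
    one_smul, smul_comm _ 2, smul_smul, hri, one_smul, mul_sub, mul_smul_comm, H.d_e, changeOp_p2]

theorem isUnit_p2_sq : IsUnit (p2 ^ 2 : Jet) := by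
  refine IsUnit.of_mul_eq_one (rpow 2) ?_
  rw [p2, neg_sq, sq, ← rpow_add, ← rpow_add]; norm_num [rpow_zero]

theorem isUnit_rpow (q : ℚ) : IsUnit (rpow q) := by
  refine IsUnit.of_mul_eq_one (rpow (-q)) ?_
  rw [← rpow_add, add_neg_cancel, rpow_zero]

theorem isUnit_Dvar {g : Jet} (hg : IsUnit g) : IsUnit (pdo (Dvar g)) :=
  ⟨⟨_, _, (isDPair_Dvar hg).d_mul_e, (isDPair_Dvar hg).e_mul_d⟩, rfl⟩

theorem isUnit_DvarInv {g : Jet} (hg : IsUnit g) : IsUnit (pdo (DvarInv g)) :=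
  ⟨⟨_, _, (isDPair_Dvar hg).e_mul_d, (isDPair_Dvar hg).d_mul_e⟩, rfl⟩

theorem isUnit_fn {f : Jet} (hf : IsUnit f) : IsUnit (pdo (fn f)) := by
  rw [pdo_fn]; exact isUnit_smul_one hf

theorem isUnit_changeOp_p2 : IsUnit (pdo (changeOp gz2 p2)) := by
  rw [changeOp_p2_eq_factor]
  exact ((isUnit_fn isUnit_p2_sq).mul ((isUnit_fn (isUnit_rpow _)).mul
    ((isUnit_Dvar isUnit_gz2).mul (isUnit_fn (isUnit_rpow _))))).mul isUnit_changeOp_v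

theorem coeff_R2 : upow 1 4 * upow 2 (-2) = Ring.inverse gz2 ^ 2 := by
  rw [inverse_gz2, mul_pow, ← pow_mul, ← upow_natCast, upow_pow]; norm_num

theorem pdo_R2 : pdo R2 = 2 • (pdo (Dvar gz2) * pdo (Dvar gz2)) -
    8 • U 1 • (pdo (DvarInv gz2) * (U 1 • pdo (Dvar gz2))) := by
  rw [R2, pdo_mul, pdo_sub, pdo_add, pdo_fn_mul, pdo_mul, pdo_fn_mul, pdo_mul, pdo_dinv, pdo_D,
    sub_mul, pdo_fn, pdo_fn, pdo_principal isUnit_gz2 coeff_R2, pdo_nonlocal isUnit_gz2, mul_smul]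
  simp only [ofNat_smul_eq_nsmul]

theorem isTransformed_R2 :
    IsTransformed (changeOp gz2 p2) R2 (fn 2 * (Dvar gz2 * Dvar gz2)) := by
  refine isTransformed_of_mul_eq isUnit_changeOp_p2 ?_
  rw [pdo_R2, pdo_mul_Dvar, changeOp_p2]
  exact (isDPair_Dvar isUnit_gz2).intertwine_linear_local dvar_gz2_w

/-! ### The variables `(∂_y⁻¹ r^(1/2), log r)` -/

/-- `∂z/∂x = u_xx^(1/2)`, up to the sign `ε`; the powers of `u_x` cancel. -/
theorem gz1_eq (ε : ℝ) : gz1 ε = ε • upow 2 (1 / 2) := by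
  rw [gz1, rsqrt, rpow_eq, gy, U_eq, upow_pow, smul_mul_assoc, mul_assoc, ← upow_add]
  norm_num [upow_zero]

section

variable {ε : ℝ} (hε : ε = 1 ∨ ε = -1)
include hε

theorem sq_eq_one_of_sign : ε * ε = 1 := by rcases hε with rfl | rfl <;> norm_num

theorem gz1_sq : gz1 ε ^ 2 = U 2 := by
  rw [gz1_eq, sq, smul_mul_smul_comm, sq_eq_one_of_sign hε, one_smul, ← upow_add]
  norm_num [U_eq]

theorem gz1_mul_inv : gz1 ε * (gz1 ε * upow 2 (-1)) = 1 := by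
  rw [← mul_assoc, ← sq, gz1_sq hε, u2_mul_inv]

theorem isUnit_gz1 : IsUnit (gz1 ε) := IsUnit.of_mul_eq_one _ (gz1_mul_inv hε)

theorem inverse_gz1 : Ring.inverse (gz1 ε) = gz1 ε * upow 2 (-1) :=
  inverse_eq_of_mul_eq_one (gz1_mul_inv hε)

end

/-- `α = ∂_z log ∂z/∂x`, where `∂z/∂x = g`. -/
def alphaV (g : Jet) : Jet := Ring.inverse g * dvar g g

/-- `φ = g / u_x`. For `∂z/∂x = g` with `g² = u_xx` this is `∂_z log u_x`. -/
def phiV (g : Jet) : Jet := g * upow 1 (-1)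

/-- `β = α - 2φ`. For `∂z/∂x = g` with `g² = u_xx` this is half of the `z`-derivative of `log r`. -/
def betaV (g : Jet) : Jet := alphaV g - 2 * phiV g

/-- `p = log r` satisfies `p' = r'/r`. -/
theorem tot_p1 : rpow 1 * tot p1 = tot (rpow 1) := by
  rw [tot_eq_sum p1 (vars p1 ∪ vars (rpow 1)), tot_eq_sum (rpow 1) (vars p1 ∪ vars (rpow 1)),
    Finset.mul_sum]
  · exact Finset.sum_congr rfl fun k _ => by rw [← mul_assoc, pd_p1]
  all_goals
    intro k hk
    simp only [Finset.mem_union, not_or] at hk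
    simp [pd_eq_zero_of_notMem_vars hk.1, pd_eq_zero_of_notMem_vars hk.2]

theorem rsqrt_eq (ε : ℝ) : rsqrt ε = gz1 ε * upow 1 (-1) ^ 2 := by
  have h2 := w_mul_inv
  rw [gz1, gy]
  grind

theorem rpow_one_eq_upow : rpow 1 = upow 1 (-4) * upow 2 1 := by
  rw [rpow_eq, mul_comm]; norm_num

theorem pd_p1_eq_zero {k : ℕ} (hk : k ∉ ({1, 2} : Finset ℕ)) : pd k p1 = 0 := by
  have h := pd_p1 k
  rw [rpow_one_eq_upow, pd_upow_mul_upow hk, ← rpow_one_eq_upow] at h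
  exact (isUnit_rpow 1).mul_right_eq_zero.mp h

theorem pd_gz1_of_ne (ε : ℝ) {k : ℕ} (hk : k ≠ 2) : pd k (gz1 ε) = 0 := by
  rw [gz1_eq, Derivation.map_smul, pd_upow_of_ne hk, smul_zero]

section

variable {ε : ℝ} (hε : ε = 1 ∨ ε = -1)
include hε

theorem gz1_mul_inverse : gz1 ε * Ring.inverse (gz1 ε) = 1 :=
  Ring.mul_inverse_cancel _ (isUnit_gz1 hε)

theorem upow_two_neg_one : upow 2 (-1) = Ring.inverse (gz1 ε) ^ 2 := by
  have h1 := gz1_mul_inverse hε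
  have h2 := inverse_gz1 hε
  have h3 := gz1_sq hε
  have h4 := u2_mul_inv
  grind

theorem U_three : U 3 = 2 * (gz1 ε * tot (gz1 ε)) := by
  rw [← tot_U 2, ← gz1_sq hε, sq, tot_mul]; ring

theorem dvar_phiV : dvar (gz1 ε) (phiV (gz1 ε)) =
    phiV (gz1 ε) * (alphaV (gz1 ε) - phiV (gz1 ε)) := by
  have h1 := gz1_mul_inverse hε
  rw [phiV, alphaV, dvar, dvar, tot_mul, tot_inv, ← gz1_sq hε]
  grind

theorem rpow_one_eq : rpow 1 = gz1 ε ^ 2 * upow 1 (-1) ^ 4 := by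
  rw [rpow_eq, upow_pow, gz1_sq hε, U_eq]; norm_num

theorem rpow_one_inv : rpow 1 * (Ring.inverse (gz1 ε) ^ 2 * U 1 ^ 4) = 1 := by
  have h1 := gz1_mul_inverse hε
  have h2 := w_mul_inv
  rw [rpow_one_eq hε]
  grind

theorem dvar_p1 : dvar (gz1 ε) p1 = 2 * betaV (gz1 ε) := by
  have h1 := gz1_mul_inverse hε
  have h2 := w_mul_inv
  have h3 := tot_p1
  have h4 := rpow_one_inv hε
  rw [rpow_one_eq hε] at h3 h4
  rw [tot_mul, tot_pow, tot_pow, tot_inv, ← gz1_sq hε] at h3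
  rw [betaV, phiV, alphaV, dvar, dvar]
  push_cast at h3
  norm_num at h3
  grind

theorem pd_one_p1 : pd 1 p1 = -(4 * upow 1 (-1)) := by
  have h1 := gz1_mul_inverse hε
  have h2 := w_mul_inv
  have h4 := rpow_one_inv hε
  have h5 := pd_p1 1
  have hr1 : pd 1 (rpow 1) = -4 * (upow 1 (-1) ^ 5 * U 2) := by
    rw [rpow_one_eq_upow, Derivation.leibniz, pd_upow_int 1 (-4 : ℤ) (by norm_num),
      pd_upow_of_ne (by norm_num), upow_pow, U_eq]
    norm_num
    ring
  rw [hr1, ← gz1_sq hε] at h5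
  rw [rpow_one_eq hε] at h4 h5
  grind

theorem pd_two_p1 : pd 2 p1 = Ring.inverse (gz1 ε) ^ 2 := by
  have h1 := gz1_mul_inverse hε
  have h2 := w_mul_inv
  have h4 := rpow_one_inv hε
  have h5 := pd_p1 2
  have hr2 : pd 2 (rpow 1) = upow 1 (-1) ^ 4 := by
    rw [rpow_one_eq_upow, Derivation.leibniz, ← U_eq, pd_U, pd_upow_of_ne (by norm_num), upow_pow]
    norm_num
  rw [hr2] at h5
  rw [rpow_one_eq hε] at h4 h5
  grind

theorem two_mul_pd_gz1 : 2 * pd 2 (gz1 ε) = Ring.inverse (gz1 ε) := by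
  have h1 := gz1_mul_inverse hε
  have : pd 2 (gz1 ε ^ 2) = 1 := by rw [gz1_sq hε, pd_U, if_pos rfl]
  rw [sq, Derivation.leibniz, smul_eq_mul] at this
  grind

theorem changeOp_p1 : pdo (changeOp (gz1 ε) p1) =
    pdo (Dvar (gz1 ε)) * pdo (Dvar (gz1 ε)) - 2 • phiV (gz1 ε) • pdo (Dvar (gz1 ε)) -
      betaV (gz1 ε) • (pdo (DvarInv (gz1 ε)) * (alphaV (gz1 ε) • pdo (Dvar (gz1 ε)))) := by
  have h1 := gz1_mul_inverse hε
  have hg := isUnit_gz1 hε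
  have H := isDPair_Dvar hg
  have h2 : 2 • (eP * pdo (frechet (gz1 ε))) = pdo (Dvar (gz1 ε)) +
      pdo (DvarInv (gz1 ε)) * (alphaV (gz1 ε) • pdo (Dvar (gz1 ε))) := by
    have hgz : 2 • pdo (frechet (gz1 ε)) = Ring.inverse (gz1 ε) • (dP * dP) := by
      rw [frechet_pair fun k hk => pd_gz1_of_ne ε (by rintro rfl; simp at hk),
        pd_gz1_of_ne ε (by norm_num), zero_smul, zero_add, ← ofNat_smul_eq_nsmul Jet, smul_smul,
        two_mul_pd_gz1 hε]
    have h3 : Ring.inverse (gz1 ε) * Ring.inverse (gz1 ε) * gz1 ε * gz1 ε = 1 := by grind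
    have h4 : Ring.inverse (gz1 ε) * Ring.inverse (gz1 ε) * gz1 ε * dvar (gz1 ε) (gz1 ε) =
        alphaV (gz1 ε) := by rw [alphaV]; grind
    rw [← mul_smul_comm, hgz, eP_smul hg, dP_mul_dP hg, smul_add, mul_add, smul_smul,
      smul_smul, smul_smul, smul_smul, h3, h4, one_smul, H.e_d]
  rw [pdo_changeOp, frechet_pair fun k hk => pd_p1_eq_zero hk, pd_one_p1 hε, pd_two_p1 hε,
    dvar_p1 hε, mul_comm 2 (betaV _), mul_smul, ofNat_smul_eq_nsmul, h2,
    dP_mul_dP hg, dP_eq hg]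
  generalize pdo (DvarInv (gz1 ε)) * (alphaV (gz1 ε) • pdo (Dvar (gz1 ε))) = x
  generalize pdo (Dvar (gz1 ε)) = d
  rw [betaV, phiV, alphaV]
  match_scalars
  · grind
  · grind
  · ring

theorem isUnit_rsqrt : IsUnit (rsqrt ε) := by
  refine IsUnit.of_mul_eq_one (ε • rpow (-(1 / 2))) ?_
  rw [rsqrt, smul_mul_smul_comm, sq_eq_one_of_sign hε, one_smul, ← rpow_add, add_neg_cancel,
    rpow_zero]

theorem changeOp_p1_eq_factor : pdo (changeOp (gz1 ε) p1) =
    pdo (fn (rpow (-1)) * (fn (rsqrt ε ^ 3) * (Dvar (gz1 ε) * (fn (Ring.inverse (rsqrt ε)) *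
      (DvarInv (gz1 ε) * (fn (Ring.inverse (rsqrt ε)) * Dvar (gz1 ε)))))) * changeOp gy v) := by
  have h1 := gz1_mul_inverse hε
  have hg := isUnit_gz1 hε
  have hw := w_mul_inv
  have hs : rsqrt ε * Ring.inverse (rsqrt ε) = 1 := Ring.mul_inverse_cancel _ (isUnit_rsqrt hε)
  have hs2 := rsqrt_sq ε hε
  have hs3 : rpow (-1) * rsqrt ε ^ 3 = rsqrt ε := by
    have : rpow (-1) * rpow 1 = 1 := by rw [← rpow_add]; norm_num [rpow_zero]
    grind
  have hs' : zder (gz1 ε) (rsqrt ε) = betaV (gz1 ε) * rsqrt ε := by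
    rw [zder_apply, rsqrt_eq ε, dvar, tot_mul, tot_pow, tot_inv, ← gz1_sq hε, betaV, phiV, alphaV,
      dvar]
    push_cast
    norm_num
    grind
  have hφ : phiV (gz1 ε) = rsqrt ε * U 1 := by
    rw [rsqrt_eq ε, phiV]
    grind
  have hv : upow 1 (-2) * gz1 ε = rsqrt ε := by rw [rsqrt_eq ε, upow_neg_two, mul_comm]
  rw [changeOp_p1 hε, ← (isDPair_Dvar hg).factor_mKdV hs hs' hφ rfl, pdo_mul, pdo_fn_mul,
    pdo_fn_mul, pdo_mul, pdo_fn_mul, pdo_mul, pdo_fn_mul, ← mul_smul (rpow (-1)), hs3,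
    changeOp_v_eq hg, hv, ← hs2, sq]
  simp only [smul_mul_assoc, mul_assoc, mul_smul]

theorem isUnit_changeOp_p1 : IsUnit (pdo (changeOp (gz1 ε) p1)) := by
  have hg := isUnit_gz1 hε
  have hs := isUnit_rsqrt hε
  rw [changeOp_p1_eq_factor hε]
  exact ((isUnit_fn (isUnit_rpow _)).mul ((isUnit_fn (hs.pow 3)).mul ((isUnit_Dvar hg).mul
    ((isUnit_fn hs.ringInverse).mul ((isUnit_DvarInv hg).mul ((isUnit_fn hs.ringInverse).mul
      (isUnit_Dvar hg))))))).mul isUnit_changeOp_v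

/-- The coefficient `u_xx^(-3/2) u_xxx` of the nonlocal term. The sign `ε` drops out of the
recursion operator, where the coefficient occurs twice. -/
theorem coeff_R1 : upow 2 (-3 / 2) * U 3 = ε • (2 * alphaV (gz1 ε)) := by
  have h1 := gz1_mul_inverse hε
  have h2 : upow 2 (-3 / 2) = ε • (gz1 ε * Ring.inverse (gz1 ε) ^ 4) := by
    have : Ring.inverse (gz1 ε) ^ 4 = upow 2 (-2) := by
      rw [upow_neg_two, upow_two_neg_one hε]; ring
    rw [this, gz1_eq, smul_mul_assoc, smul_smul, sq_eq_one_of_sign hε, one_smul, ← upow_add]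
    norm_num
  rw [h2, smul_mul_assoc, U_three hε, alphaV, dvar]
  congr 1
  grind

theorem pdo_R1 : pdo R1 = 4 • (pdo (Dvar (gz1 ε)) * pdo (Dvar (gz1 ε)) -
    alphaV (gz1 ε) • (pdo (DvarInv (gz1 ε)) * (alphaV (gz1 ε) • pdo (Dvar (gz1 ε))))) := by
  have hg := isUnit_gz1 hε
  have hc : ∀ c : Jet, c = ε • (2 * alphaV (gz1 ε)) →
      c • (pdo (DvarInv (gz1 ε)) * (c • pdo (Dvar (gz1 ε)))) = 4 • (alphaV (gz1 ε) •
        (pdo (DvarInv (gz1 ε)) * (alphaV (gz1 ε) • pdo (Dvar (gz1 ε))))) := by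
    rintro c rfl
    have h2 : ∀ T : PDO, pdo (DvarInv (gz1 ε)) * ((2 : Jet) • T) =
        2 • (pdo (DvarInv (gz1 ε)) * T) := fun T => by
      rw [ofNat_smul_eq_nsmul]; exact mul_smul_comm (2 : ℕ) _ _
    rcases hε with rfl | rfl
    · rw [one_smul, mul_smul, mul_smul, h2]
      module
    · rw [neg_one_smul, neg_smul, neg_smul, mul_smul, mul_smul, mul_neg, h2]
      module
  have hp := pdo_principal hg (f := upow 2 (-1)) (upow_two_neg_one hε)
  have hp' : ((2 * upow 2 (-1)) • dP + (2 : Jet) • (dP * upow 2 (-1) • (1 : PDO))) =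
      2 • (upow 2 (-1) • dP + dP * (upow 2 (-1) • 1)) := by
    rw [mul_smul, smul_add]
    simp only [ofNat_smul_eq_nsmul]
  rw [R1, pdo_mul, pdo_sub, pdo_add, pdo_fn_mul, pdo_fn_mul, pdo_mul, pdo_fn_mul, pdo_mul,
    pdo_dinv, pdo_D, sub_mul, pdo_fn, pdo_fn, pdo_nonlocal hg, hc _ (coeff_R1 hε), hp',
    smul_mul_assoc, hp, smul_sub, smul_smul]
  rfl

theorem isTransformed_R1 :
    IsTransformed (changeOp (gz1 ε) p1) R1 (pmKdVOp (gz1 ε) p1) := by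
  have hg := isUnit_gz1 hε
  refine isTransformed_of_mul_eq (isUnit_changeOp_p1 hε) ?_
  have h := (isDPair_Dvar hg).intertwine_mKdV (dvar_phiV hε) (β := betaV (gz1 ε)) rfl
  rw [pdo_pmKdVOp hg, pdo_R1 hε, dvar_p1 hε, changeOp_p1 hε, mul_smul_comm, h, ← smul_mul_assoc]
  have h2 : ∀ T : PDO, pdo (DvarInv (gz1 ε)) * ((2 : Jet) • T) =
      2 • (pdo (DvarInv (gz1 ε)) * T) := fun T => by
    rw [ofNat_smul_eq_nsmul]; exact mul_smul_comm (2 : ℕ) _ _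
  rw [mul_smul, mul_smul, h2]
  congr 1
  module

end

/-! ### The mKdV hierarchy of differential polynomials -/

/-- The derivation of the algebra of differential polynomials in one variable `a`, where `X k`
stands for the `k`-th derivative of `a`. -/
def dX : Derivation ℝ (MvPolynomial ℕ ℝ) (MvPolynomial ℕ ℝ) :=
  MvPolynomial.mkDerivation ℝ fun k => MvPolynomial.X (k + 1)

theorem dX_X (k : ℕ) : dX (MvPolynomial.X k) = MvPolynomial.X (k + 1) :=
  MvPolynomial.mkDerivation_X _ _ _

/-- A primitive with constant coefficient `0` if there is a primitive at all, and `0` otherwise. -/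
def prim (f : MvPolynomial ℕ ℝ) : MvPolynomial ℕ ℝ :=
  open Classical in
  if h : ∃ g, dX g = f then h.choose - MvPolynomial.C (MvPolynomial.constantCoeff h.choose) else 0

theorem constantCoeff_prim (f : MvPolynomial ℕ ℝ) : MvPolynomial.constantCoeff (prim f) = 0 := by
  rw [prim]
  split_ifs <;> simp

theorem dX_prim {f : MvPolynomial ℕ ℝ} (h : f ∈ LinearMap.range dX.toLinearMap) :
    dX (prim f) = f := by
  have h' : ∃ g, dX g = f := h
  rw [prim, dif_pos h', map_sub, h'.choose_spec, MvPolynomial.derivation_C, sub_zero]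

/-- The members `L n = (4∂² - a ∂⁻¹ a ∂)ⁿ a` of the mKdV hierarchy. -/
def mkdv : ℕ → MvPolynomial ℕ ℝ
  | 0 => MvPolynomial.X 0
  | n + 1 => 4 * dX (dX (mkdv n)) - MvPolynomial.X 0 * prim (MvPolynomial.X 0 * dX (mkdv n))

/-- The nonlocal term `∂⁻¹ (a ∂ L n)`. -/
def mkdvPrim (n : ℕ) : MvPolynomial ℕ ℝ := prim (MvPolynomial.X 0 * dX (mkdv n))

theorem mkdv_succ (n : ℕ) :
    mkdv (n + 1) = 4 * dX (dX (mkdv n)) - MvPolynomial.X 0 * mkdvPrim n := rfl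

/-- The primitive of `a ∂ L n` exists. The operator `4∂² - a ∂⁻¹ a ∂` is symmetric for the pairing
`(f, g) ↦ f ∂ g` of differential polynomials up to total derivatives, and this pairing is
skew-symmetric; so `a ∂ L n = L 0 ∂ L n` is equivalent to `L n ∂ L 0`, hence to its own negative. -/
theorem X_mul_dX_mkdv_mem_range (n : ℕ) :
    MvPolynomial.X 0 * dX (mkdv n) ∈ LinearMap.range dX.toLinearMap := by
  induction n using Nat.strong_induction_on with
  | _ n ih =>
    have hsymm : ∀ i j, i + j + 1 ≤ n →
        mkdv i * dX (mkdv (j + 1)) - mkdv (i + 1) * dX (mkdv j) ∈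
          LinearMap.range dX.toLinearMap := by
      intro i j hij
      have hi : dX (mkdvPrim i) = MvPolynomial.X 0 * dX (mkdv i) := dX_prim (ih i (by omega))
      have hj : dX (mkdvPrim j) = MvPolynomial.X 0 * dX (mkdv j) := dX_prim (ih j (by omega))
      -- Here `f ∂G - F ∂g = ∂(f G - 4 f' g' + h k)` for `F = 4f'' - a h` and `G = 4g'' - a k`.
      refine ⟨mkdv i * mkdv (j + 1) - 4 * (dX (mkdv i) * dX (mkdv j)) + mkdvPrim i * mkdvPrim j, ?_⟩
      change dX _ = _
      have h4 : dX (4 : MvPolynomial ℕ ℝ) = 0 := dX.map_natCast 4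
      simp only [map_add, map_sub, Derivation.leibniz, h4, hi, hj, smul_eq_mul]
      rw [mkdv_succ i, mkdv_succ j]
      simp only [map_sub, Derivation.leibniz, h4, hj, smul_eq_mul]
      ring
    have hchain : ∀ i j, i + j = n →
        mkdv 0 * dX (mkdv n) - mkdv i * dX (mkdv j) ∈ LinearMap.range dX.toLinearMap := by
      intro i
      induction i with
      | zero =>
        rintro j rfl
        simp
      | succ i ihi =>
        intro j hj
        have := add_mem (ihi (j + 1) (by omega)) (hsymm i j (by omega))
        rwa [sub_add_sub_cancel] at this
    have h0 : dX (mkdv 0 * mkdv n) ∈ LinearMap.range dX.toLinearMap := ⟨_, rfl⟩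
    rw [Derivation.leibniz, smul_eq_mul, smul_eq_mul] at h0
    have h2 := Submodule.smul_mem _ (1 / 2 : ℝ) (add_mem (hchain n 0 (by omega)) h0)
    convert h2 using 1
    change mkdv 0 * dX (mkdv n) = _
    module

theorem dX_mkdvPrim (n : ℕ) : dX (mkdvPrim n) = MvPolynomial.X 0 * dX (mkdv n) :=
  dX_prim (X_mul_dX_mkdv_mem_range n)

theorem constantCoeff_dX (f : MvPolynomial ℕ ℝ) : MvPolynomial.constantCoeff (dX f) = 0 := by
  induction f using MvPolynomial.induction_on with
  | C r => simp [dX]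
  | add f g hf hg => simp [hf, hg]
  | mul_X f k hf => simp [hf, dX_X]

theorem constantCoeff_mkdv (n : ℕ) : MvPolynomial.constantCoeff (mkdv n) = 0 := by
  cases n with
  | zero => simp [mkdv]
  | succ n => simp [mkdv_succ, constantCoeff_dX]

section

variable {A : Type*} [CommRing A] [Algebra ℝ A] (δ : Derivation ℝ A A)

/-- The value of a differential polynomial at an element `a` of a differential algebra. -/
def devalAt (a : A) : MvPolynomial ℕ ℝ →ₐ[ℝ] A := MvPolynomial.aeval fun k => δ^[k] a

theorem devalAt_X (a : A) (k : ℕ) : devalAt δ a (MvPolynomial.X k) = δ^[k] a :=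
  MvPolynomial.aeval_X _ _

theorem devalAt_dX (a : A) (f : MvPolynomial ℕ ℝ) : devalAt δ a (dX f) = δ (devalAt δ a f) := by
  induction f using MvPolynomial.induction_on with
  | C r => simp [dX, devalAt]
  | add f g hf hg => simp only [map_add, hf, hg]
  | mul_X f k hf =>
    simp only [Derivation.leibniz, smul_eq_mul, map_add, map_mul, hf, dX_X, devalAt_X,
      Function.iterate_succ_apply']

theorem devalAt_mkdv_zero (a : A) : devalAt δ a (mkdv 0) = a := devalAt_X δ a 0

theorem devalAt_mkdv_succ (a : A) (n : ℕ) : devalAt δ a (mkdv (n + 1)) =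
    4 * δ (δ (devalAt δ a (mkdv n))) - a * devalAt δ a (mkdvPrim n) := by
  rw [mkdv_succ, map_sub, map_mul, map_mul, devalAt_dX, devalAt_dX, devalAt_X, map_ofNat]
  rfl

theorem devalAt_mkdvPrim (a : A) (n : ℕ) :
    δ (devalAt δ a (mkdvPrim n)) = a * δ (devalAt δ a (mkdv n)) := by
  rw [← devalAt_dX, dX_mkdvPrim, map_mul, devalAt_dX, devalAt_X]
  rfl

theorem aeval_rename_succ (q : A) (f : MvPolynomial ℕ ℝ) :
    MvPolynomial.aeval (fun k => δ^[k] q) (MvPolynomial.rename Nat.succ f) =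
      devalAt δ (δ q) f := by
  rw [MvPolynomial.aeval_rename]
  rfl

end

/-! ### Degrees and constants of integration -/

theorem aeval_sub_mem_degLE {c t : ℚ} (ht : t ≤ 0) {x : ℕ → Jet} (hx : ∀ k, x k ∈ degLE c t)
    (f : MvPolynomial ℕ ℝ) : MvPolynomial.aeval x f -
      algebraMap ℝ Jet (MvPolynomial.constantCoeff f) ∈ degLE c t := by
  induction f using MvPolynomial.induction_on with
  | C r => simp
  | add f g hf hg =>
    simp only [map_add, add_sub_add_comm]
    exact add_mem hf hg
  | mul_X f k hf =>
    simp only [map_mul, MvPolynomial.aeval_X, MvPolynomial.constantCoeff_X, mul_zero, map_zero,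
      sub_zero]
    have h1 := degLE_mono (t := t) (by linarith) (mul_mem_degLE hf (hx k))
    have h2 := Submodule.smul_mem _ (MvPolynomial.constantCoeff f) (hx k)
    rw [Algebra.smul_def] at h2
    have := add_mem h1 h2
    rwa [sub_mul, sub_add_cancel] at this

theorem devalAt_mem_degLE {δ : Derivation ℝ Jet Jet} {a : Jet} {c t : ℚ} (ht : t ≤ 0)
    (ha : ∀ k, δ^[k] a ∈ degLE c t) {f : MvPolynomial ℕ ℝ}
    (hf : MvPolynomial.constantCoeff f = 0) : devalAt δ a f ∈ degLE c t := by
  have := aeval_sub_mem_degLE ht ha f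
  rwa [hf, map_zero, sub_zero] at this

theorem iterate_mem_degLE {δ : Derivation ℝ Jet Jet} {a : Jet} {c t : ℚ} (ha : a ∈ degLE c t)
    (hδ : ∀ f ∈ degLE c t, δ f ∈ degLE c t) (k : ℕ) : δ^[k] a ∈ degLE c t := by
  induction k with
  | zero => exact ha
  | succ k ih => rw [Function.iterate_succ_apply']; exact hδ _ ih

theorem eq_of_tot_eq_of_mem_degLE {c t : ℚ} (ht : t < 0) {f g : Jet} (hf : f ∈ degLE c t)
    (hg : g ∈ degLE c t) (h : tot f = tot g) : f = g :=
  eq_of_tot_eq h ((constTerm_eq_zero_of_mem_degLE ht hf).trans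
    (constTerm_eq_zero_of_mem_degLE ht hg).symm)

theorem eq_of_dvar_eq {c t : ℚ} (ht : t < 0) {g : Jet} (hg : IsUnit g) {f f' : Jet}
    (hf : f ∈ degLE c t) (hf' : f' ∈ degLE c t) (h : dvar g f = dvar g f') : f = f' :=
  eq_of_tot_eq_of_mem_degLE ht hf hf' (by rw [tot_eq_dvar hg, h, ← tot_eq_dvar hg])

/-! ### The potential mKdV hierarchy -/

theorem Apply_smul {T : NOp} {f g : Jet} (r : ℝ) (h : T.Apply f g) : T.Apply (r • f) (r • g) := by
  induction T generalizing f g with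
  | diff c =>
    rw [apply_diff] at h ⊢
    rw [h, Finsupp.smul_sum]
    simp only [map_smul, mul_smul_comm]
  | dinv =>
    rw [apply_dinv] at h ⊢
    refine ⟨by rw [map_smul, h.1], ?_⟩
    have := h.2
    simp only [constTerm] at this ⊢
    simp [this]
  | add S T hS hT =>
    obtain ⟨g₁, g₂, h₁, h₂, rfl⟩ := h
    exact ⟨_, _, hS h₁, hT h₂, smul_add _ _ _⟩
  | comp S T hS hT =>
    obtain ⟨k, h₁, h₂⟩ := h
    exact ⟨_, hT h₁, hS h₂⟩

/-- Monomials in the jet coordinates are monomials with natural exponents and without logarithms. -/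
theorem ofPoly_monomial (s : ℕ →₀ ℕ) (r : ℝ) : ofPoly (MvPolynomial.monomial s r) =
    AddMonoidAlgebra.single (s.mapRange Nat.cast Nat.cast_zero, 0) r := by
  have hs : (s.prod fun k n => U k ^ n) = mon (s.mapRange Nat.cast Nat.cast_zero) := by
    induction s using Finsupp.induction_linear with
    | zero => simp [mon_zero]
    | add s t hs ht =>
      rw [Finsupp.prod_add_index' (by simp) (by intro _ _ _; exact pow_add _ _ _), hs, ht,
        ← mon_add, ← Finsupp.mapRange_add (by exact Nat.cast_add)]
    | single k n =>
      rw [Finsupp.prod_single_index (by simp), ← upow_natCast, Finsupp.mapRange_single]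
      rfl
  rw [ofPoly, MvPolynomial.aeval_monomial, hs, mon, ← Algebra.smul_def,
    AddMonoidAlgebra.smul_single, smul_eq_mul, mul_one]

theorem ofPoly_injective : Function.Injective ofPoly := by
  have key : ∀ (f : MvPolynomial ℕ ℝ) (s : ℕ →₀ ℕ),
      (ofPoly f).coeff (s.mapRange Nat.cast Nat.cast_zero, 0) = f.coeff s := by
    classical
    intro f s
    induction f using MvPolynomial.induction_on' with
    | monomial t r =>
      rw [ofPoly_monomial, AddMonoidAlgebra.coeff_single, Finsupp.single_apply,
        MvPolynomial.coeff_monomial]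
      refine if_congr ?_ rfl rfl
      rw [Prod.mk.injEq, and_iff_left rfl]
      exact (Finsupp.mapRange_injective _ Nat.cast_zero Nat.cast_injective).eq_iff
    | add f g hf hg =>
      rw [ofPoly, map_add, AddMonoidAlgebra.coeff_add, Finsupp.add_apply, MvPolynomial.coeff_add,
        ← hf, ← hg]
      rfl
  intro f g h
  ext s
  rw [← key, h, key]

/-- The potential mKdV hierarchy: up to a factor, the mKdV hierarchy without its first member, with
`a = p_z`. -/
def pmkdv (n : ℕ) : MvPolynomial ℕ ℝ :=
  MvPolynomial.C (1 / 16) * MvPolynomial.rename Nat.succ (mkdv (n + 1))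

theorem aeval_pmkdv {A : Type*} [CommRing A] [Algebra ℝ A] (δ : Derivation ℝ A A) (q : A) (n : ℕ) :
    MvPolynomial.aeval (fun k => δ^[k] q) (pmkdv n) =
      (1 / 16 : ℝ) • devalAt δ (δ q) (mkdv (n + 1)) := by
  rw [pmkdv, map_mul, aeval_rename_succ, MvPolynomial.aeval_C, Algebra.smul_def]

theorem ofPoly_pmkdv (n : ℕ) :
    ofPoly (pmkdv n) = (1 / 16 : ℝ) • devalAt totD (U 1) (mkdv (n + 1)) := by
  have h : ∀ k, U k = totD^[k] (U 0) := by
    intro k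
    induction k with
    | zero => rfl
    | succ k ih => rw [Function.iterate_succ_apply', ← ih, totD_apply, tot_U]
  rw [ofPoly, show U = fun k => totD^[k] (U 0) from funext h, aeval_pmkdv]
  rfl

theorem totD_iterate_U_mem (k : ℕ) : totD^[k] (U 1) ∈ degLE (-1) (-1) :=
  iterate_mem_degLE (upow_mem_degLE _ _ (by norm_num)) (fun _ hf => tot_mem_degLE hf) k

theorem apply_pmKdVOp_devalAt (n : ℕ) : (pmKdVOp 1 (U 0)).Apply (devalAt totD (U 1) (mkdv n))
    (devalAt totD (U 1) (mkdv (n + 1))) := by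
  have hL := devalAt_mem_degLE (by norm_num) totD_iterate_U_mem (constantCoeff_mkdv n)
  have hP := devalAt_mem_degLE (by norm_num) totD_iterate_U_mem
    (constantCoeff_prim (MvPolynomial.X 0 * dX (mkdv n)))
  have hd := devalAt_mkdvPrim totD (U 1) n
  have hs := devalAt_mkdv_succ totD (U 1) n
  rw [mkdvPrim] at hd hs
  set f := devalAt totD (U 1) (mkdv n)
  set h := devalAt totD (U 1) (prim (MvPolynomial.X 0 * dX (mkdv n)))
  rw [totD_apply, totD_apply] at hd
  rw [totD_apply, totD_apply] at hs
  rw [pmKdVOp, apply_add]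
  simp only [apply_sub, apply_mul, apply_fn, Dvar, DvarInv, apply_D, apply_dinv, dvar,
    Ring.inverse_one, one_mul, tot_U]
  -- Integration by parts: `∂⁻¹ (p_zz f) = p_z f - ∂⁻¹ (p_z f')`.
  refine ⟨_, _, ⟨_, _, ⟨_, ⟨_, ⟨_, rfl, rfl⟩, _, rfl, rfl⟩, rfl⟩, rfl, rfl⟩,
    ⟨U 1 * f - h, ⟨_, rfl, _, rfl, ?_, ?_⟩, rfl⟩, ?_⟩
  · rw [map_sub, tot_mul, hd, tot_U]
    ring
  · refine constTerm_eq_zero_of_mem_degLE (c := -1) (t := -1) (by norm_num) (sub_mem ?_ hP)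
    exact degLE_mono (by norm_num) (mul_mem_degLE (totD_iterate_U_mem 0) hL)
  · rw [hs]
    ring

theorem isPmKdVHierarchy_pmkdv : IsPmKdVHierarchy pmkdv := by
  refine ⟨?_, fun n => ?_⟩
  · have h0 : devalAt totD (U 1) (mkdvPrim 0) = (1 / 2 : ℝ) • (U 1 * U 1) := by
      refine eq_of_tot_eq_of_mem_degLE (c := -1) (t := -1) (by norm_num)
        (devalAt_mem_degLE (by norm_num) totD_iterate_U_mem (constantCoeff_prim _))
        (Submodule.smul_mem _ _ (degLE_mono (by norm_num)
          (mul_mem_degLE (totD_iterate_U_mem 0) (totD_iterate_U_mem 0)))) ?_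
      rw [← totD_apply, devalAt_mkdvPrim, devalAt_mkdv_zero, totD_apply, map_smul, tot_mul]
      module
    change ofPoly (pmkdv 0) = pmKdVFlow
    rw [ofPoly_pmkdv, devalAt_mkdv_succ, h0, devalAt_mkdv_zero, totD_apply, totD_apply, tot_U,
      tot_U, pmKdVFlow, mul_smul_comm, smul_sub, smul_smul]
    have h4 : (4 : Jet) * U 3 = (4 : ℝ) • U 3 := by
      rw [Algebra.smul_def, map_ofNat]
    rw [h4, smul_smul]
    norm_num
    ring
  · change (pmKdVOp 1 (U 0)).Apply (ofPoly (pmkdv n)) (ofPoly (pmkdv (n + 1)))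
    rw [ofPoly_pmkdv, ofPoly_pmkdv]
    exact Apply_smul _ (apply_pmKdVOp_devalAt (n + 1))

theorem isPmKdVHierarchy_iff (H : ℕ → MvPolynomial ℕ ℝ) : IsPmKdVHierarchy H ↔ H = pmkdv := by
  refine ⟨fun h => ?_, fun h => h ▸ isPmKdVHierarchy_pmkdv⟩
  funext n
  refine ofPoly_injective ?_
  induction n with
  | zero => exact h.1.trans isPmKdVHierarchy_pmkdv.1.symm
  | succ n ih =>
    have h1 := h.2 n
    simp only [ih] at h1
    exact Apply_unique h1 (isPmKdVHierarchy_pmkdv.2 n)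

/-! ### The Miura transformation -/

section

variable {A : Type*} [CommRing A] [Algebra ℝ A] {δ : Derivation ℝ A A}

/-- The image of the first member of the mKdV hierarchy, with `2α²` and `2β²` as the primitives of
`2α(2α)'` and `2β(2β)'`. -/
theorem miura_zero {α β φ : A} (hφ : δ φ = φ * (α - φ)) (hβ : β = α - 2 * φ) :
    4 * δ (δ (2 * α)) - 8 * φ * δ (2 * α) - 2 * β * (2 * α ^ 2) =
      4 * δ (δ (2 * β)) - 2 * β * (2 * β ^ 2) := by
  subst hβ
  simp only [map_sub, Derivation.leibniz, derivation_ofNat δ 2, mul_zero, add_zero, hφ,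
    smul_eq_mul]
  ring

/-- With the Miura image `M = 4f'' - 8φf' - 2βh`, where `h' = 2αf'`, this is the primitive of
`2βM'` in terms of the primitive `h₁` that belongs to the next member `4f'' - 2αh`. -/
theorem miura_prim {α β φ f h h₁ : A} (hφ : δ φ = φ * (α - φ)) (hβ : β = α - 2 * φ)
    (hh : δ h = 2 * α * δ f) (hh₁ : δ h₁ = 2 * α * δ (4 * δ (δ f) - 2 * α * h)) :
    δ (h₁ - 16 * φ * δ (δ f) + 16 * δ φ * δ f - 16 * β * φ * δ f + 8 * δ φ * h) =
      2 * β * δ (4 * δ (δ f) - 8 * φ * δ f - 2 * β * h) := by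
  subst hβ
  simp only [map_sub, map_add, Derivation.leibniz, derivation_ofNat δ 2, derivation_ofNat δ 4,
    derivation_ofNat δ 8, derivation_ofNat δ 16, mul_zero, add_zero, hφ, hh, hh₁, smul_eq_mul]
  ring

/-- The Miura image of `4f'' - 2αh` is `4M'' - 2βk`, where `k` is the primitive of `2βM'`. -/
theorem miura_succ {α β φ f h h₁ : A} (hφ : δ φ = φ * (α - φ)) (hβ : β = α - 2 * φ)
    (hh : δ h = 2 * α * δ f) :
    4 * δ (δ (4 * δ (δ f) - 2 * α * h)) - 8 * φ * δ (4 * δ (δ f) - 2 * α * h) - 2 * β * h₁ =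
      4 * δ (δ (4 * δ (δ f) - 8 * φ * δ f - 2 * β * h)) -
      2 * β * (h₁ - 16 * φ * δ (δ f) + 16 * δ φ * δ f - 16 * β * φ * δ f + 8 * δ φ * h) := by
  subst hβ
  simp only [map_sub, map_add, Derivation.leibniz, derivation_ofNat δ 2, derivation_ofNat δ 4,
    derivation_ofNat δ 8, mul_zero, add_zero, hφ, hh, smul_eq_mul]
  ring

end

theorem tot_two : tot (2 : Jet) = 0 := derivation_ofNat totD 2

theorem constTerm_add (f g : Jet) : constTerm (f + g) = constTerm f + constTerm g := by
  simp [constTerm]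

theorem constTerm_smul (r : ℝ) (f : Jet) : constTerm (r • f) = r * constTerm f := by
  simp [constTerm]

theorem euler_eq_sum (f : Jet) (s : Finset ℕ) (h : ∀ k, k ∉ s → pd k f = 0) :
    euler f = ∑ k ∈ s, ((-tot) ^ k) (pd k f) := by
  change ((grad f).sum fun k g => ((-tot) ^ k) g) = _
  refine Finsupp.sum_of_support_subset _ (fun k hk => ?_) _ (by simp)
  by_contra hks
  exact (Finsupp.mem_support_iff.mp hk) (h k hks)

theorem mul_mem_degLE_of_zero {c t : ℚ} {f g : Jet} (hf : f ∈ degLE c 0) (hg : g ∈ degLE c t) :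
    f * g ∈ degLE c t := by
  have := mul_mem_degLE hf hg
  rwa [zero_add] at this

theorem dvar_mem_degLE {c s t : ℚ} {g f : Jet} (hg : Ring.inverse g ∈ degLE c s)
    (hf : f ∈ degLE c t) : dvar g f ∈ degLE c (s + t) :=
  mul_mem_degLE hg (tot_mem_degLE hf)

theorem natCast_mem_degLE (c : ℚ) (n : ℕ) : (n : Jet) ∈ degLE c 0 := by
  rw [← nsmul_one]
  exact nsmul_mem (one_mem_degLE le_rfl) n

theorem ofNat_mul_mem_degLE {c t : ℚ} {f : Jet} (n : ℕ) [n.AtLeastTwo] (hf : f ∈ degLE c t) :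
    (OfNat.ofNat n : Jet) * f ∈ degLE c t :=
  mul_mem_degLE_of_zero (natCast_mem_degLE c (OfNat.ofNat n)) hf

/-! ### The first hierarchy -/

theorem mul_mem_degLE_half {f g : Jet} (hf : f ∈ degLE 1 (-1 / 2)) (hg : g ∈ degLE 1 (-1 / 2)) :
    f * g ∈ degLE 1 (-1 / 2) :=
  degLE_mono (by norm_num) (mul_mem_degLE hf hg)

section

variable {ε : ℝ} (hε : ε = 1 ∨ ε = -1)

theorem gz1_mem_degLE (ε : ℝ) : gz1 ε ∈ degLE 1 (1 / 2) := by
  rw [gz1_eq]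
  exact Submodule.smul_mem _ _ (upow_mem_degLE _ _ (by norm_num))

theorem phiV_mem_degLE (ε : ℝ) : phiV (gz1 ε) ∈ degLE 1 (-1 / 2) :=
  degLE_mono (by norm_num)
    (mul_mem_degLE (gz1_mem_degLE ε) (upow_mem_degLE (t := -1) _ _ (by norm_num)))

include hε

theorem inverse_gz1_mem_degLE : Ring.inverse (gz1 ε) ∈ degLE 1 (-1 / 2) := by
  rw [inverse_gz1 hε]
  exact degLE_mono (by norm_num)
    (mul_mem_degLE (gz1_mem_degLE ε) (upow_mem_degLE (t := -1) _ _ (by norm_num)))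

theorem zder_gz1_mem_degLE (f : Jet) (hf : f ∈ degLE 1 (-1 / 2)) :
    zder (gz1 ε) f ∈ degLE 1 (-1 / 2) :=
  degLE_mono (by norm_num) (dvar_mem_degLE (inverse_gz1_mem_degLE hε) hf)

theorem alphaV_mem_degLE : alphaV (gz1 ε) ∈ degLE 1 (-1 / 2) :=
  degLE_mono (by norm_num) (mul_mem_degLE (inverse_gz1_mem_degLE hε)
    (dvar_mem_degLE (inverse_gz1_mem_degLE hε) (gz1_mem_degLE ε)))

theorem betaV_mem_degLE : betaV (gz1 ε) ∈ degLE 1 (-1 / 2) :=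
  sub_mem (alphaV_mem_degLE hε) (ofNat_mul_mem_degLE 2 (phiV_mem_degLE ε))

theorem devalAt_gz1_mem_degLE {a : Jet} (ha : a ∈ degLE 1 (-1 / 2)) {f : MvPolynomial ℕ ℝ}
    (hf : MvPolynomial.constantCoeff f = 0) : devalAt (zder (gz1 ε)) a f ∈ degLE 1 (-1 / 2) :=
  devalAt_mem_degLE (by norm_num) (iterate_mem_degLE ha (zder_gz1_mem_degLE hε)) hf

theorem devalAt_mkdvPrim_zero {a : Jet} (ha : 2 * a ∈ degLE 1 (-1 / 2))
    (ha' : a ∈ degLE 1 (-1 / 2)) :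
    devalAt (zder (gz1 ε)) (2 * a) (mkdvPrim 0) = 2 * a ^ 2 := by
  refine eq_of_dvar_eq (c := 1) (t := -1 / 2) (by norm_num) (isUnit_gz1 hε)
    (devalAt_gz1_mem_degLE hε ha (constantCoeff_prim _)) ?_ ?_
  · rw [sq]
    exact ofNat_mul_mem_degLE 2 (mul_mem_degLE_half ha' ha')
  · rw [← zder_apply, ← zder_apply, devalAt_mkdvPrim, devalAt_mkdv_zero]
    simp only [sq, Derivation.leibniz, derivation_ofNat (zder (gz1 ε)) 2, smul_eq_mul]
    ring

/-- The operator of the change of variables maps the mKdV hierarchy with `a = 2α` to the mKdV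
hierarchy with `a = 2β`, shifted by one. -/
theorem miura_mkdv (n : ℕ) :
    4 * zder (gz1 ε) (zder (gz1 ε) (devalAt (zder (gz1 ε)) (2 * alphaV (gz1 ε)) (mkdv n))) -
      8 * phiV (gz1 ε) * zder (gz1 ε) (devalAt (zder (gz1 ε)) (2 * alphaV (gz1 ε)) (mkdv n)) -
      2 * betaV (gz1 ε) * devalAt (zder (gz1 ε)) (2 * alphaV (gz1 ε)) (mkdvPrim n) =
    devalAt (zder (gz1 ε)) (2 * betaV (gz1 ε)) (mkdv (n + 1)) := by
  have hα := alphaV_mem_degLE hε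
  have hβ := betaV_mem_degLE hε
  have hα2 := ofNat_mul_mem_degLE 2 hα
  have hβ2 := ofNat_mul_mem_degLE 2 hβ
  have hφ := phiV_mem_degLE ε
  have hδ := zder_gz1_mem_degLE hε
  have e := dvar_phiV hε
  rw [← zder_apply] at e
  induction n with
  | zero =>
    rw [devalAt_mkdv_succ, devalAt_mkdvPrim_zero hε hα2 hα, devalAt_mkdvPrim_zero hε hβ2 hβ,
      devalAt_mkdv_zero, devalAt_mkdv_zero]
    exact miura_zero e rfl
  | succ n ih =>
    have hh := devalAt_mkdvPrim (zder (gz1 ε)) (2 * alphaV (gz1 ε)) n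
    have hh₁ := devalAt_mkdvPrim (zder (gz1 ε)) (2 * alphaV (gz1 ε)) (n + 1)
    rw [devalAt_mkdv_succ] at hh₁
    have hk := miura_prim e (β := betaV (gz1 ε)) rfl hh hh₁
    have hs := miura_succ e (β := betaV (gz1 ε)) (h₁ := devalAt (zder (gz1 ε)) (2 * alphaV (gz1 ε))
      (mkdvPrim (n + 1))) rfl hh
    rw [ih] at hk hs
    have hf := devalAt_gz1_mem_degLE hε hα2 (constantCoeff_mkdv n)
    have hp := devalAt_gz1_mem_degLE hε hα2 (f := mkdvPrim n) (constantCoeff_prim _)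
    have hp₁ := devalAt_gz1_mem_degLE hε hα2 (f := mkdvPrim (n + 1)) (constantCoeff_prim _)
    -- Both sides are primitives of `2βM'` of negative degree.
    have heq := eq_of_dvar_eq (c := 1) (t := -1 / 2) (by norm_num) (isUnit_gz1 hε)
      (devalAt_gz1_mem_degLE hε hβ2 (f := mkdvPrim (n + 1)) (constantCoeff_prim _))
      (by
        have hm : ∀ {f g : Jet}, f ∈ degLE 1 (-1 / 2) → g ∈ degLE 1 (-1 / 2) →
          f * g ∈ degLE 1 (-1 / 2) := mul_mem_degLE_half
        simp only [mul_assoc]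
        exact add_mem (sub_mem (add_mem (sub_mem hp₁
          (ofNat_mul_mem_degLE 16 (hm hφ (hδ _ (hδ _ hf)))))
          (ofNat_mul_mem_degLE 16 (hm (hδ _ hφ) (hδ _ hf))))
          (ofNat_mul_mem_degLE 16 (hm hβ (hm hφ (hδ _ hf)))))
          (ofNat_mul_mem_degLE 8 (hm (hδ _ hφ) hp)))
      (((devalAt_mkdvPrim _ _ _).trans hk.symm :))
    rw [devalAt_mkdv_succ _ _ (n + 1), heq, ← hs, devalAt_mkdv_succ _ _ n]

theorem tot_inverse_gz1 : tot (Ring.inverse (gz1 ε)) = -alphaV (gz1 ε) := by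
  have h1 := gz1_mul_inverse hε
  have := congrArg tot h1
  rw [tot_mul, show tot (1 : Jet) = 0 from totD.map_one_eq_zero] at this
  rw [alphaV, dvar]
  grind

/-- The function `h` is a nonlocal term: `h = ∂_z⁻¹ (2α ∂_z K)`. -/
theorem apply_R1 {K h : Jet} (hh : tot h = 2 * alphaV (gz1 ε) * tot K) (h0 : constTerm h = 0) :
    R1.Apply K (4 * dvar (gz1 ε) (dvar (gz1 ε) K) - 2 * alphaV (gz1 ε) * h) := by
  have hi := tot_inverse_gz1 hε
  have hs := sq_eq_one_of_sign hε
  rw [R1]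
  simp only [apply_mul, apply_sub, apply_add, apply_fn, apply_D, apply_dinv, coeff_R1 hε]
  refine ⟨_, rfl, _, _, ⟨_, _, ⟨_, rfl, rfl⟩, ⟨_, ⟨_, rfl, rfl⟩, rfl⟩, rfl⟩,
    ⟨ε • h, ⟨_, rfl, ?_, ?_⟩, rfl⟩, ?_⟩
  · rw [map_smul, hh, smul_mul_assoc]
  · simp only [constTerm] at h0 ⊢
    simp [h0]
  · rw [smul_mul_smul_comm, hs, one_smul, upow_two_neg_one hε, dvar, dvar, tot_mul, tot_mul, sq,
      tot_mul, hi]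
    ring

theorem apply_changeOp_p1 {K h : Jet} (hh : tot h = 2 * alphaV (gz1 ε) * tot K)
    (h0 : constTerm h = 0) (h0' : constTerm (dvar (gz1 ε) K) = 0) :
    (changeOp (gz1 ε) p1).Apply K ((1 / 4 : ℝ) • (4 * dvar (gz1 ε) (dvar (gz1 ε) K) -
      8 * phiV (gz1 ε) * dvar (gz1 ε) K - 2 * betaV (gz1 ε) * h)) := by
  have hi := tot_inverse_gz1 hε
  have h2 := two_mul_pd_gz1 hε
  have hp : Ring.inverse (gz1 ε) * tot p1 = 2 * betaV (gz1 ε) := dvar_p1 hε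
  obtain ⟨c, hc, hcs⟩ : ∃ c : Jet, 4 * c = 1 ∧ ∀ f : Jet, (1 / 4 : ℝ) • f = c * f := by
    refine ⟨algebraMap ℝ Jet (1 / 4), ?_, fun f => Algebra.smul_def _ _⟩
    rw [← map_ofNat (algebraMap ℝ Jet), ← map_mul, ← map_one (algebraMap ℝ Jet)]
    norm_num
  rw [changeOp, apply_sub]
  simp only [apply_mul, apply_fn, apply_dinv, apply_frechet_pair fun k hk => pd_p1_eq_zero hk]
  -- `∂⁻¹ g_u K = (2 ∂_z K + h) / 4` since `g_u = ∂² / (2g)`.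
  refine ⟨_, _, rfl, ⟨(1 / 4 : ℝ) • (2 * dvar (gz1 ε) K + h), ⟨_,
    (apply_frechet_pair (fun k hk => pd_gz1_of_ne ε (by rintro rfl; simp at hk)) _ _).mpr rfl,
    ?_, ?_⟩, rfl⟩, ?_⟩
  · rw [map_smul, map_add, tot_mul, hh, pd_gz1_of_ne ε (by norm_num), hcs,
      tot_two, dvar, tot_mul, hi]
    linear_combination (-2 * c * tot (tot K)) * h2 + pd 2 (gz1 ε) * tot (tot K) * hc
  · rw [constTerm_smul, two_mul, constTerm_add, constTerm_add, h0, h0']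
    norm_num
  · rw [pd_one_p1 hε, pd_two_p1 hε, hp, hcs, hcs, betaV, phiV, dvar, dvar, tot_mul, hi]
    have h1 := gz1_mul_inverse hε
    grind

/-- The first hierarchy. It does not depend on the sign `ε`, see `kOne_eq`. -/
def kOne (ε : ℝ) (n : ℕ) : Jet :=
  (-(ε / 4)) • devalAt (zder (gz1 ε)) (2 * alphaV (gz1 ε)) (mkdv n)

theorem kOne_zero : kOne ε 0 = -(1 / 4 : ℝ) • (upow 2 (-3 / 2) * U 3) := by
  rw [kOne, devalAt_mkdv_zero, coeff_R1 hε, smul_smul]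
  congr 1
  ring

theorem isHierarchyOf_kOne : IsHierarchyOf R1 (upow 2 (1 / 2)) (kOne ε) := by
  have hα2 := ofNat_mul_mem_degLE 2 (alphaV_mem_degLE hε)
  have hf := fun n => devalAt_gz1_mem_degLE hε hα2 (constantCoeff_mkdv n)
  have hp := fun n => devalAt_gz1_mem_degLE hε hα2 (f := mkdvPrim n) (constantCoeff_prim _)
  refine ⟨?_, rfl, fun n => ?_⟩
  · rw [apply_dinv]
    refine ⟨?_, ?_⟩
    · have he : euler (upow 2 (1 / 2)) = tot (tot (pd 2 (upow 2 (1 / 2)))) := by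
        rw [euler_eq_sum _ {2} fun k hk => pd_upow_of_ne (by simpa using hk) _]
        simp [pow_succ]
      rw [he, kOne_zero hε, pd_upow_self, map_smul tot (_ : ℝ) (upow 2 _), tot_upow,
        smul_smul]
      norm_num
    · rw [kOne, constTerm_smul, constTerm_eq_zero_of_mem_degLE (by norm_num) (hf 0), mul_zero]
  · refine Apply_smul _ ?_
    rw [devalAt_mkdv_succ]
    refine apply_R1 hε ?_ (constTerm_eq_zero_of_mem_degLE (by norm_num) (hp n))
    have := devalAt_mkdvPrim (zder (gz1 ε)) (2 * alphaV (gz1 ε)) n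
    rw [zder_apply, zder_apply] at this
    rw [tot_eq_dvar (isUnit_gz1 hε), this, tot_eq_dvar (isUnit_gz1 hε)]
    ring

theorem apply_kOne (n : ℕ) : (changeOp (gz1 ε) p1).Apply (kOne ε n)
    ((-ε) • MvPolynomial.aeval (fun k => (dvar (gz1 ε))^[k] p1) (pmkdv n)) := by
  have hα2 := ofNat_mul_mem_degLE 2 (alphaV_mem_degLE hε)
  have hf := devalAt_gz1_mem_degLE hε hα2 (constantCoeff_mkdv n)
  have hp := devalAt_gz1_mem_degLE hε hα2 (f := mkdvPrim n) (constantCoeff_prim _)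
  have hd := devalAt_mkdvPrim (zder (gz1 ε)) (2 * alphaV (gz1 ε)) n
  rw [zder_apply, zder_apply] at hd
  have h := Apply_smul (-(ε / 4)) (apply_changeOp_p1 hε
    (h := devalAt (zder (gz1 ε)) (2 * alphaV (gz1 ε)) (mkdvPrim n))
    (by rw [tot_eq_dvar (isUnit_gz1 hε), hd, tot_eq_dvar (isUnit_gz1 hε)]; ring)
    (constTerm_eq_zero_of_mem_degLE (by norm_num) hp)
    (constTerm_eq_zero_of_mem_degLE (by norm_num) (zder_gz1_mem_degLE hε _ hf)))
  have hm := miura_mkdv hε n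
  simp only [zder_apply] at hm
  rw [hm, smul_smul] at h
  have ha := aeval_pmkdv (zder (gz1 ε)) p1 n
  rw [zder_apply, dvar_p1 hε] at ha
  rw [show (fun k => (dvar (gz1 ε))^[k] p1) = fun k => (zder (gz1 ε))^[k] p1 from rfl, ha,
    smul_smul]
  rw [show -ε * (1 / 16) = -(ε / 4) * (1 / 4) by ring]
  exact h

theorem kOne_eq : kOne ε = kOne 1 :=
  (isHierarchyOf_iff_eq (isHierarchyOf_kOne (Or.inl rfl)) _).mp (isHierarchyOf_kOne hε)

end

/-! ### Principal parts and Euler derivatives -/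

theorem mul_tot_tot_add {g f : Jet} (hf : f = Ring.inverse g ^ 2) (K : Jet) :
    f * tot (tot K) + tot (f * tot K) = 2 * dvar g (dvar g K) := by
  rw [hf, dvar, dvar, sq, tot_mul, tot_mul, tot_mul]
  ring

theorem euler_pair {f : Jet} (h : ∀ k, k ∉ ({1, 2} : Finset ℕ) → pd k f = 0) :
    euler f = tot (tot (pd 2 f) - pd 1 f) := by
  rw [euler_eq_sum f _ h, Finset.sum_pair (by norm_num)]
  simp [pow_succ]
  abel

theorem two_pow_smul (n : ℕ) (f : Jet) : (2 : ℝ) ^ n • f = 2 ^ n * f := by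
  rw [Algebra.smul_def, map_pow, map_ofNat]

theorem two_pow_succ_smul (n : ℕ) (f : Jet) :
    (2 : ℝ) ^ (n + 1) • f = (2 : ℝ) ^ n • (2 * f) := by
  rw [pow_succ, mul_smul, Algebra.smul_def (2 : ℝ), map_ofNat]

/-! ### The second hierarchy -/

/-- The function `m` is the nonlocal term `∂⁻¹ (u_x ∂K)`. -/
theorem apply_R2 {K m : Jet} (hm : tot m = U 1 * tot K) (h0 : constTerm m = 0) :
    R2.Apply K (2 * dvar gz2 (dvar gz2 K) - 8 * U 1 * m) := by
  rw [R2]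
  simp only [apply_mul, apply_sub, apply_add, apply_fn, apply_D, apply_dinv]
  exact ⟨_, rfl, _, _, ⟨_, _, ⟨_, rfl, rfl⟩, ⟨_, rfl, rfl⟩, rfl⟩, ⟨m, ⟨_, rfl, hm, h0⟩, rfl⟩,
    by rw [mul_tot_tot_add coeff_R2]⟩

theorem apply_changeOp_p2 {K : Jet} (h0 : constTerm (upow 1 (-2) * tot K) = 0) :
    (changeOp gz2 p2).Apply K (dvar gz2 (dvar gz2 K) - 2 * U 1 * dvar gz2 K) := by
  have h1 := w_mul_inv
  have h2 := u2_mul_inv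
  have hp : Ring.inverse gz2 * tot p2 = _ := dvar_p2
  rw [changeOp, apply_sub]
  simp only [apply_mul, apply_fn, apply_dinv, apply_frechet_pair fun k hk => pd_p2_eq_zero hk]
  refine ⟨_, _, rfl, ⟨upow 1 (-2) * tot K, ⟨_,
    (apply_frechet_pair (fun k hk => pd_gz2_eq_zero hk) _ _).mpr rfl, ?_, h0⟩, rfl⟩, ?_⟩
  · rw [tot_mul, pd_one_gz2, pd_two_gz2]
    ring
  · rw [pd_one_p2, pd_two_p2, hp, dvar, dvar, inverse_gz2, tot_mul, tot_mul, tot_pow, tot_inv,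
      tot_U, upow_neg_two]
    push_cast
    norm_num
    grind

theorem w_mem_degLE : U 1 ∈ degLE (-1) (-1) := upow_mem_degLE _ _ (by norm_num)

theorem iterate_p2_mem_degLE (k : ℕ) : (zder gz2)^[k] p2 ∈ degLE (-1) (-3) := by
  refine iterate_mem_degLE ?_ (fun f hf => ?_) k
  · rw [p2_eq_upow]
    exact neg_mem (degLE_mono (by norm_num) (mul_mem_degLE (s := -4) (t := 1)
      (upow_mem_degLE _ _ (by norm_num)) (upow_mem_degLE _ _ (by norm_num))))
  · refine degLE_mono (by norm_num) (dvar_mem_degLE (s := -1) ?_ hf)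
    rw [inverse_gz2, ← upow_natCast]
    exact degLE_mono (by norm_num) (mul_mem_degLE (s := -2) (t := 1)
      (upow_mem_degLE _ _ (by norm_num)) (upow_mem_degLE _ _ (by norm_num)))

/-- The member of the second hierarchy that corresponds to the symmetry `∂_v³ q`. -/
def preTwo (q : Jet) : Jet := dvar gz2 q + 2 * U 1 * q

theorem dvar_preTwo (q : Jet) : dvar gz2 (preTwo q) =
    dvar gz2 (dvar gz2 q) + 2 * U 1 * dvar gz2 q + 2 * U 1 ^ 2 * q := by
  have hw : zder gz2 (U 1) = U 1 ^ 2 := dvar_gz2_w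
  simp only [preTwo, ← zder_apply, map_add, Derivation.leibniz, derivation_ofNat (zder gz2) 2, hw,
    smul_eq_mul]
  ring

theorem dvar_dvar_preTwo (q : Jet) : dvar gz2 (dvar gz2 (preTwo q)) =
    dvar gz2 (dvar gz2 (dvar gz2 q)) + 2 * U 1 * dvar gz2 (dvar gz2 q) +
      4 * U 1 ^ 2 * dvar gz2 q + 4 * U 1 ^ 3 * q := by
  have hw : zder gz2 (U 1) = U 1 ^ 2 := dvar_gz2_w
  rw [dvar_preTwo]
  simp only [sq, ← zder_apply, map_add, Derivation.leibniz, derivation_ofNat (zder gz2) 2, hw,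
    smul_eq_mul]
  ring

/-- The second hierarchy. -/
def kTwo (n : ℕ) : Jet := (2 : ℝ) ^ (n + 1) • preTwo ((zder gz2)^[2 * n] p2)

theorem kTwo_zero :
    kTwo 0 = 2 * (upow 1 6 * upow 2 (-3) * U 3) - 12 * (upow 1 5 * upow 2 (-1)) := by
  have h1 : upow 1 6 = U 1 ^ 6 := by rw [← upow_natCast]; norm_num
  have h2 : upow 1 5 = U 1 ^ 5 := by rw [← upow_natCast]; norm_num
  have h3 : upow 2 (-3) = upow 2 (-1) ^ 3 := by rw [upow_pow]; norm_num
  rw [kTwo, two_pow_smul, preTwo]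
  change _ * (dvar gz2 p2 + 2 * U 1 * p2) = _
  rw [dvar_p2, p2_eq, h1, h2, h3]
  ring

theorem preTwo_mem_degLE {q : Jet} (hq : q ∈ degLE (-1) (-3)) (hq' : dvar gz2 q ∈ degLE (-1) (-3)) :
    preTwo q ∈ degLE (-1) (-3) := by
  rw [preTwo, mul_assoc]
  exact add_mem hq' (ofNat_mul_mem_degLE 2 
    (degLE_mono (by norm_num) (mul_mem_degLE w_mem_degLE hq)))

theorem isHierarchyOf_kTwo : IsHierarchyOf R2 (upow 1 6 * upow 2 (-1)) kTwo := by
  have hm := iterate_p2_mem_degLE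
  refine ⟨?_, rfl, fun n => ?_⟩
  · rw [apply_dinv, euler_pair fun k hk => pd_upow_mul_upow hk]
    constructor
    · have h1 : upow 1 6 = U 1 ^ 6 := by rw [← upow_natCast]; norm_num
      have h2 : upow 1 5 = U 1 ^ 5 := by rw [← upow_natCast]; norm_num
      have h3 : upow 2 (-3) = upow 2 (-1) ^ 3 := by rw [upow_pow]; norm_num
      have h4 : pd 1 (upow 1 6) = 6 * U 1 ^ 5 := by
        rw [pd_upow_int 1 (6 : ℤ) (by norm_num), ← h2]; norm_num
      have h5 := u2_mul_inv
      rw [kTwo_zero, Derivation.leibniz, Derivation.leibniz, h4, pd_inv,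
        pd_upow_of_ne (by norm_num), pd_upow_of_ne (by norm_num), h1, h2, h3]
      simp only [smul_eq_mul, mul_zero, add_zero, zero_add, mul_neg, map_neg]
      congr 1
      rw [tot_mul, tot_pow, tot_pow, tot_inv, tot_U]
      push_cast
      norm_num
      grind
    · have h1 := hm (2 * 0 + 1)
      rw [Function.iterate_succ_apply'] at h1
      rw [kTwo, constTerm_smul, constTerm_eq_zero_of_mem_degLE (c := -1) (t := -3) (by norm_num)
        (preTwo_mem_degLE (hm _) h1), mul_zero]
  · rw [kTwo, kTwo, two_pow_succ_smul (n + 1)]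
    refine Apply_smul _ ?_
    rw [show 2 * (n + 1) = 2 * n + 1 + 1 by ring, Function.iterate_succ_apply',
      Function.iterate_succ_apply']
    have h0 := hm (2 * n)
    have h1 := hm (2 * n + 1)
    rw [Function.iterate_succ_apply'] at h1
    set q := (zder gz2)^[2 * n] p2
    have hw : zder gz2 (U 1) = U 1 ^ 2 := dvar_gz2_w
    have h := apply_R2 (K := preTwo q) (m := U 1 * dvar gz2 q + U 1 ^ 2 * q) (by
        rw [tot_eq_dvar isUnit_gz2, tot_eq_dvar isUnit_gz2 (preTwo q), dvar_preTwo]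
        simp only [sq, ← zder_apply, map_add, Derivation.leibniz, hw, smul_eq_mul]
        ring)
      (constTerm_eq_zero_of_mem_degLE (c := -1) (t := -3) (by norm_num) (add_mem
        (degLE_mono (by norm_num) (mul_mem_degLE w_mem_degLE h1))
        (degLE_mono (by norm_num) (mul_mem_degLE
          (sq (U 1) ▸ mul_mem_degLE w_mem_degLE w_mem_degLE) h0))))
    rw [dvar_dvar_preTwo] at h
    convert h using 1
    rw [preTwo, zder_apply, zder_apply]
    ring

theorem apply_kTwo (n : ℕ) : (changeOp gz2 p2).Apply (kTwo n)
    (2 ^ (n + 1) * (dvar gz2)^[2 * n + 3] p2) := by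
  have hm := iterate_p2_mem_degLE
  rw [← two_pow_smul, kTwo]
  refine Apply_smul _ ?_
  have h0 := hm (2 * n)
  have h1 := hm (2 * n + 1)
  rw [Function.iterate_succ_apply'] at h1
  have h := apply_changeOp_p2 (K := preTwo ((zder gz2)^[2 * n] p2))
    (constTerm_eq_zero_of_mem_degLE (c := -1) (t := -1) (by norm_num) (degLE_mono (by norm_num)
      (mul_mem_degLE (s := 2) (upow_mem_degLE _ _ (by norm_num))
        (tot_mem_degLE (preTwo_mem_degLE h0 h1)))))
  rw [dvar_dvar_preTwo, dvar_preTwo] at h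
  convert h using 1
  rw [Function.iterate_succ_apply', Function.iterate_succ_apply', Function.iterate_succ_apply']
  change dvar gz2 (dvar gz2 (dvar gz2 ((zder gz2)^[2 * n] p2))) = _
  ring

/-! ### The third hierarchy -/

/-- The functions `m₁` and `m₂` are the nonlocal terms `∂⁻¹ (u_x ∂K)` and `∂⁻¹ (h ∂K)`. -/
theorem apply_R3 {K m₁ m₂ : Jet} (h₁ : tot m₁ = U 1 * tot K) (h₁' : constTerm m₁ = 0)
    (h₂ : tot m₂ = h3 * tot K) (h₂' : constTerm m₂ = 0) :
    R3.Apply K (2 * dvar gy (dvar gy K) - 4 * h3 * m₁ - 4 * U 1 * m₂) := by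
  rw [R3]
  simp only [apply_mul, apply_sub, apply_add, apply_fn, apply_D, apply_dinv]
  exact ⟨_, rfl, _, _, ⟨_, _, ⟨_, _, ⟨_, rfl, rfl⟩, ⟨_, rfl, rfl⟩, rfl⟩,
    ⟨m₁, ⟨_, rfl, h₁, h₁'⟩, rfl⟩, rfl⟩, ⟨m₂, ⟨_, rfl, h₂, h₂'⟩, rfl⟩,
    by rw [mul_tot_tot_add coeff_R3]⟩

theorem apply_changeOp_v {K m : Jet} (hm : tot m = 2 * U 1 * tot K) (h0 : constTerm m = 0) :
    (changeOp gy v).Apply K (dvar gy K - dvar gy v * m) := by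
  rw [changeOp, apply_sub]
  simp only [apply_mul, apply_fn, apply_dinv]
  refine ⟨_, _, (apply_frechet v {1} (fun k hk => ?_) _ _).mpr rfl, ⟨m, ⟨_,
    (apply_frechet gy {1} (fun k hk => ?_) _ _).mpr rfl, ?_, h0⟩, rfl⟩, ?_⟩
  · simp only [Finset.mem_singleton] at hk; simp [v, pd_upow_of_ne hk]
  · simp only [Finset.mem_singleton] at hk; simp [gy, pd_U, hk, Derivation.leibniz_pow]
  · simp [hm, gy, pd_U, Derivation.leibniz_pow]
  · rw [Finset.sum_singleton, v, map_neg, pd_inv, neg_neg, pow_one, dvar, dvar, inverse_gy,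
      upow_neg_two]

/-- A differential polynomial in `v` with the `y`-derivative `v_i v_{i+2m+1}`, obtained by
integrating by parts until the orders of the two factors differ by one. -/
def quadPrim (i m : ℕ) : Jet :=
  match m with
  | 0 => (1 / 2 : ℝ) • ((zder gy)^[i] v * (zder gy)^[i] v)
  | m + 1 => (zder gy)^[i] v * (zder gy)^[i + 2 * m + 2] v - quadPrim (i + 1) m

theorem zder_quadPrim (i m : ℕ) :
    zder gy (quadPrim i m) = (zder gy)^[i] v * (zder gy)^[i + 2 * m + 1] v := by
  induction m generalizing i with
  | zero =>
    rw [quadPrim, Derivation.map_smul, Derivation.leibniz, mul_zero, add_zero,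
      Function.iterate_succ_apply', smul_eq_mul]
    module
  | succ m ih =>
    rw [quadPrim, map_sub, ih, Derivation.leibniz, smul_eq_mul, smul_eq_mul,
      show i + 1 + 2 * m + 1 = i + 2 * m + 2 by ring, ← Function.iterate_succ_apply' (zder gy),
      ← Function.iterate_succ_apply' (zder gy),
      show i + 2 * (m + 1) + 1 = i + 2 * m + 2 + 1 by ring]
    ring

theorem v_mem_degLE : v ∈ degLE 1 (-1) := neg_mem (upow_mem_degLE _ _ (by norm_num))

theorem iterate_v_mem_degLE (k : ℕ) : (zder gy)^[k + 1] v ∈ degLE 1 (-3) := by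
  have hi : Ring.inverse gy ∈ degLE 1 (-2) := by
    rw [inverse_gy]; exact upow_mem_degLE _ _ (by norm_num)
  rw [Function.iterate_succ_apply]
  exact iterate_mem_degLE (degLE_mono (by norm_num) (dvar_mem_degLE hi v_mem_degLE))
    (fun f hf => degLE_mono (by norm_num) (dvar_mem_degLE hi hf)) k

theorem quadPrim_mem_degLE (i m : ℕ) : quadPrim (i + 1) m ∈ degLE 1 (-6) := by
  induction m generalizing i with
  | zero =>
    exact Submodule.smul_mem _ _ (degLE_mono (by norm_num)
      (mul_mem_degLE (iterate_v_mem_degLE i) (iterate_v_mem_degLE i)))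
  | succ m ih =>
    exact sub_mem (degLE_mono (by norm_num)
      (mul_mem_degLE (iterate_v_mem_degLE i) (iterate_v_mem_degLE _))) (ih _)

theorem quadPrim_zero_mem_degLE (m : ℕ) : quadPrim 0 (m + 1) ∈ degLE 1 (-4) :=
  sub_mem (degLE_mono (by norm_num) (mul_mem_degLE v_mem_degLE (iterate_v_mem_degLE _)))
    (degLE_mono (by norm_num) (quadPrim_mem_degLE 0 m))

theorem w_mul_v : U 1 * v = -1 := by rw [v, mul_neg, w_mul_inv]

theorem dvar_gy_w : dvar gy (U 1) = U 1 ^ 2 * dvar gy v := by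
  have h1 := w_mul_inv
  rw [dvar, dvar, tot_v, tot_U, inverse_gy, upow_neg_two]
  grind

theorem h3_eq_v : h3 = dvar gy (dvar gy v) + U 1 * dvar gy v ^ 2 := by
  have h1 := w_mul_inv
  have hw : zder gy (U 1) = U 1 ^ 2 * zder gy v := dvar_gy_w
  have h2 : dvar gy (U 1) * upow 1 (-1) = U 1 * zder gy v := by rw [← zder_apply, hw]; grind
  rw [h3_eq, h2]
  simp only [← zder_apply, Derivation.leibniz, hw, smul_eq_mul]
  grind

/-- The member of the third hierarchy that corresponds to the symmetry `∂_y q`, where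
`∂_y A = v ∂_y q`. -/
def preThree (A q : Jet) : Jet := -(2 * U 1 * A) - q

theorem dvar_preThree {A q : Jet} (hA : zder gy A = v * zder gy q) :
    dvar gy (preThree A q) = dvar gy q - 2 * U 1 ^ 2 * dvar gy v * A := by
  have h1 := w_mul_v
  have hw : zder gy (U 1) = U 1 ^ 2 * zder gy v := dvar_gy_w
  rw [preThree]
  simp only [← zder_apply, map_sub, map_neg, Derivation.leibniz, derivation_ofNat (zder gy) 2, hw,
    hA, smul_eq_mul]
  linear_combination (-2 * zder gy q) * h1

theorem tot_neg_w_sq_mul {A q : Jet} (hA : zder gy A = v * zder gy q) :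
    tot (-(U 1 ^ 2 * A)) = U 1 * tot (preThree A q) := by
  have h1 := w_mul_v
  have hw : zder gy (U 1) = U 1 ^ 2 * zder gy v := dvar_gy_w
  rw [tot_eq_dvar isUnit_gy, tot_eq_dvar isUnit_gy (preThree A q), dvar_preThree hA]
  simp only [sq, ← zder_apply, map_neg, Derivation.leibniz, hw, hA, smul_eq_mul]
  linear_combination (-gy * U 1 * zder gy q) * h1

/-- The recursion operator takes the symmetry of `q` to twice the symmetry of `∂_y² q`. The new
primitive of `v ∂_y³ q` is obtained from `B` by integrating by parts twice. -/
theorem apply_R3_preThree {A B q : Jet} (hA : zder gy A = v * zder gy q)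
    (hB : zder gy B = zder gy (zder gy v) * zder gy q) (hA' : A ∈ degLE 1 (-4))
    (hB' : B ∈ degLE 1 (-6)) : R3.Apply (preThree A q)
      (2 * preThree (v * zder gy (zder gy q) - (zder gy v * zder gy q - B))
        (zder gy (zder gy q))) := by
  have h1 := w_mul_v
  have hw : zder gy (U 1) = U 1 ^ 2 * zder gy v := dvar_gy_w
  have hW : U 1 ^ 2 ∈ degLE 1 2 := by rw [U, upow_pow]; exact upow_mem_degLE _ _ (by norm_num)
  have hv' : zder gy v ∈ degLE 1 (-3) := iterate_v_mem_degLE 0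
  have hWA := mul_mem_degLE hW hA'
  have h := apply_R3 (tot_neg_w_sq_mul hA)
    (constTerm_eq_zero_of_mem_degLE (c := 1) (by norm_num) (neg_mem hWA))
    (m₂ := B - zder gy v ^ 2 * (U 1 ^ 2 * A)) (by
      rw [tot_eq_dvar isUnit_gy, tot_eq_dvar isUnit_gy (preThree A q), dvar_preThree hA, h3_eq_v]
      simp only [sq, ← zder_apply, map_sub, Derivation.leibniz, hw, hA, hB, smul_eq_mul]
      linear_combination (-gy * U 1 * zder gy v ^ 2 * zder gy q) * h1)
    (constTerm_eq_zero_of_mem_degLE (c := 1) (t := -6) (by norm_num) (sub_mem hB'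
      (degLE_mono (by norm_num) (mul_mem_degLE (sq (zder gy v) ▸ mul_mem_degLE hv' hv') hWA))))
  convert h using 1
  rw [dvar_preThree hA, h3_eq_v, preThree]
  simp only [sq, ← zder_apply, map_sub, Derivation.leibniz, derivation_ofNat (zder gy) 2, hw, hA,
    smul_eq_mul]
  have h2 : U 1 * v = -1 := h1
  grind

/-- The third hierarchy. -/
def kThree (n : ℕ) : Jet :=
  (2 : ℝ) ^ (n + 1) • preThree (quadPrim 0 (n + 1)) ((zder gy)^[2 * n + 2] v)

theorem zder_quadPrim_zero (n : ℕ) :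
    zder gy (quadPrim 0 (n + 1)) = v * zder gy ((zder gy)^[2 * n + 2] v) := by
  rw [zder_quadPrim, ← Function.iterate_succ_apply' (zder gy),
    show 0 + 2 * (n + 1) + 1 = 2 * n + 2 + 1 by ring]
  rfl

theorem kThree_zero : kThree 0 = 2 * (upow 1 (-6) * U 3) - 6 * (upow 1 (-7) * upow 2 2) := by
  have h1 := w_mul_v
  have h2 : 2 * quadPrim 0 1 = 2 * (v * zder gy (zder gy v)) - zder gy v * zder gy v := by
    change 2 * (v * zder gy (zder gy v) - (1 / 2 : ℝ) • (zder gy v * zder gy v)) = _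
    rw [mul_sub, two_mul ((1 / 2 : ℝ) • _)]
    module
  have h : kThree 0 = 2 * h3 := by
    rw [kThree, two_pow_smul, h3_eq_v, preThree]
    change _ * (-(2 * U 1 * quadPrim 0 1) - zder gy (zder gy v)) = _
    simp only [← zder_apply]
    grind
  rw [h, h3]
  ring

theorem isHierarchyOf_kThree : IsHierarchyOf R3 (upow 1 (-6) * upow 2 2) kThree := by
  refine ⟨?_, rfl, fun n => ?_⟩
  · rw [apply_dinv, euler_pair fun k hk => pd_upow_mul_upow hk]
    constructor
    · have h2 : upow 2 2 = U 2 ^ 2 := by rw [← upow_natCast]; norm_num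
      have h4 : pd 1 (upow 1 (-6)) = -6 * upow 1 (-7) := by
        rw [pd_upow_int 1 (-6 : ℤ) (by norm_num)]; norm_num
      have h5 : pd 2 (upow 2 2) = 2 * U 2 := by
        rw [pd_upow_int 2 (2 : ℤ) (by norm_num), U_eq]; norm_num
      have h6 : tot (upow 1 (-6)) = -6 * (upow 1 (-7) * U 2) := by
        rw [tot_upow_int 1 (-6 : ℤ) (by norm_num)]; norm_num
      rw [kThree_zero, Derivation.leibniz, Derivation.leibniz, h4, h5, pd_upow_of_ne (by norm_num),
        pd_upow_of_ne (by norm_num), h2]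
      simp only [smul_eq_mul, mul_zero, add_zero, zero_add]
      congr 1
      rw [tot_mul, tot_mul, h6, tot_U, tot_two]
      ring
    · refine constTerm_eq_zero_of_mem_degLE (c := 1) (t := -3) (by norm_num) ?_
      refine Submodule.smul_mem _ _ (sub_mem (neg_mem ?_) (iterate_v_mem_degLE _))
      rw [mul_assoc]
      exact ofNat_mul_mem_degLE 2 (degLE_mono (by norm_num) (mul_mem_degLE
        (upow_mem_degLE (t := 1) _ _ (by norm_num)) (quadPrim_zero_mem_degLE 0)))
  · rw [kThree, kThree, two_pow_succ_smul (n + 1)]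
    refine Apply_smul _ ?_
    have h := apply_R3_preThree (zder_quadPrim_zero n) (B := quadPrim 2 n)
      (by rw [zder_quadPrim, ← Function.iterate_succ_apply' (zder gy),
            show 2 + 2 * n + 1 = 2 * n + 2 + 1 by ring]; rfl)
      (quadPrim_zero_mem_degLE n) (quadPrim_mem_degLE 1 n)
    rw [← Function.iterate_succ_apply' (zder gy), ← Function.iterate_succ_apply' (zder gy)] at h
    convert h using 4
    · rw [quadPrim, quadPrim, show 0 + 2 * (n + 1) + 2 = 2 * n + 2 + 1 + 1 by ring,
        show 0 + 1 + 2 * n + 2 = 2 * n + 2 + 1 by ring]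
      rfl
    · rfl

theorem apply_kThree (n : ℕ) : (changeOp gy v).Apply (kThree n)
    (2 ^ (n + 1) * (dvar gy)^[2 * n + 3] v) := by
  rw [← two_pow_smul, kThree]
  refine Apply_smul _ ?_
  have hW : U 1 ^ 2 ∈ degLE 1 2 := by rw [U, upow_pow]; exact upow_mem_degLE _ _ (by norm_num)
  have hA := zder_quadPrim_zero n
  have h := apply_changeOp_v (K := preThree (quadPrim 0 (n + 1)) ((zder gy)^[2 * n + 2] v))
    (m := -(U 1 ^ 2 * quadPrim 0 (n + 1)) + -(U 1 ^ 2 * quadPrim 0 (n + 1)))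
    (by rw [map_add, tot_neg_w_sq_mul hA]; ring)
    (by
      have := neg_mem (mul_mem_degLE hW (quadPrim_zero_mem_degLE n))
      exact constTerm_eq_zero_of_mem_degLE (by norm_num) (add_mem this this))
  rw [dvar_preThree hA] at h
  convert h using 1
  rw [Function.iterate_succ_apply']
  change dvar gy ((zder gy)^[2 * n + 2] v) = _
  ring

end HunterSaxton

end

open HunterSaxton HunterSaxton.NOp in
theorem mainTheorem5 :
    -- the operators of the successive changes of variables
    (changeOp gy w).toPDO = (fn w * (D * (fn (upow 1 (-2)) * (dinv * (fn w * D))))).toPDO ∧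
    (changeOp gy v).toPDO = (fn (upow 1 (-2)) * changeOp gy w).toPDO ∧
    (∀ ε : ℝ, ε = 1 ∨ ε = -1 →
      (changeOp (gz1 ε) p1).toPDO =
        (fn (rpow (-1)) * (fn (rsqrt ε ^ 3) * (Dvar (gz1 ε) * (fn (Ring.inverse (rsqrt ε)) *
          (DvarInv (gz1 ε) * (fn (Ring.inverse (rsqrt ε)) * Dvar (gz1 ε)))))) *
            changeOp gy v).toPDO) ∧
    (changeOp gz2 p2).toPDO =
      (fn (p2 ^ 2) * (fn (rpow 2) * (Dvar gz2 * fn (rpow (-1)))) * changeOp gy v).toPDO ∧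
    -- the recursion operators in the new variables
    (∀ ε : ℝ, ε = 1 ∨ ε = -1 →
      IsTransformed (changeOp (gz1 ε) p1) R1 (pmKdVOp (gz1 ε) p1)) ∧
    IsRecursionOperator (pmKdVOp 1 (U 0)) pmKdVFlow ∧
    IsTransformed (changeOp gz2 p2) R2 (fn 2 * (Dvar gz2 * Dvar gz2)) ∧
    IsTransformed (changeOp gy v) R3 (fn 2 * (Dvar gy * Dvar gy)) ∧
    -- the hierarchies in the new variables
    ∃ (K1 K2 K3 : ℕ → Jet) (H : ℕ → MvPolynomial ℕ ℝ),
      (∀ K, IsHierarchyOf R1 (upow 2 (1 / 2)) K ↔ K = K1) ∧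
      (∀ K, IsHierarchyOf R2 (upow 1 6 * upow 2 (-1)) K ↔ K = K2) ∧
      (∀ K, IsHierarchyOf R3 (upow 1 (-6) * upow 2 2) K ↔ K = K3) ∧
      (∀ H', IsPmKdVHierarchy H' ↔ H' = H) ∧
      K1 0 = -(1 / 4 : ℝ) • (upow 2 (-3 / 2) * U 3) ∧
      K2 0 = 2 * (upow 1 6 * upow 2 (-3) * U 3) - 12 * (upow 1 5 * upow 2 (-1)) ∧
      K3 0 = 2 * (upow 1 (-6) * U 3) - 6 * (upow 1 (-7) * upow 2 2) ∧
      (∀ ε : ℝ, ε = 1 ∨ ε = -1 → ∀ (n : ℕ) (f : Jet),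
        (changeOp (gz1 ε) p1).Apply (K1 n) f ↔
          f = (-ε) • MvPolynomial.aeval (fun k => (dvar (gz1 ε))^[k] p1) (H n)) ∧
      (∀ (n : ℕ) (f : Jet), (changeOp gz2 p2).Apply (K2 n) f ↔
        f = 2 ^ (n + 1) * (dvar gz2)^[2 * n + 3] p2) ∧
      (∀ (n : ℕ) (f : Jet), (changeOp gy v).Apply (K3 n) f ↔
        f = 2 ^ (n + 1) * (dvar gy)^[2 * n + 3] v) := by
  refine ⟨changeOp_w, changeOp_v.trans (pdo_fn_mul _ _).symm, fun ε hε => changeOp_p1_eq_factor hε,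
    changeOp_p2_eq_factor, fun ε hε => isTransformed_R1 hε, isRecursionOperator_pmKdV,
    isTransformed_R2, isTransformed_R3, kOne 1, kTwo, kThree, pmkdv,
    isHierarchyOf_iff_eq (isHierarchyOf_kOne (Or.inl rfl)), isHierarchyOf_iff_eq isHierarchyOf_kTwo,
    isHierarchyOf_iff_eq isHierarchyOf_kThree, isPmKdVHierarchy_iff, kOne_zero (Or.inl rfl),
    kTwo_zero, kThree_zero, fun ε hε n f => ?_, fun n => apply_iff_eq (apply_kTwo n),
    fun n => apply_iff_eq (apply_kThree n)⟩
  rw [← kOne_eq hε]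
  exact apply_iff_eq (apply_kOne hε n) f
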